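/- **Setting.** Let $\Omega=\{x\in\mathbb{R}^d:\|x\|\le 1\}$. For $\phi:\mathbb{R}^d\to\mathbb{R}\cup\{+\infty\}$ let $\phi^*(y)=\sup_{x\in\mathbb{R}^d}\{\langle x,y\rangle-\phi(x)\}$. For a class $\Phi$ of such functions, finite on $\Omega$, let $N(\varepsilon,\Phi)$ be the least number of functions on $\Omega$ such that every $\phi\in\Phi$ is within $\varepsilon$ of one of them in the sup-norm on $\Omega$. Let $\gamma\in[0,1)$, $R,K,c\in\mathbb{R}$, $\varepsilon_0>0$ and $\rho<1$. Assume that $\mu,\nu$ are probability measures on $\mathbb{R}^d$ and that $\Phi$ is a class of functions $\phi:\mathbb{R}^d\to\mathbb{R}\cup\{+\infty\}$ such that: 1. $\operatorname{supp}\mu\subseteq\{\|x\|\le\rho\}$, $\operatorname{supp}\nu\subseteq\Omega$, and there is $\varphi\in\Phi$ with $\nu=(\nabla\varphi)_\#\mu$; 2. every $\phi\in\Phi$ satisfies $|\phi|\le R$ on $\Omega$, $\phi(0)=0$, and $\phi=+\infty$ off $\Omega$; it is lower semicontinuous on $\mathbb{R}^d$, $\tfrac12$-strongly convex on $\Omega$,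 and $C^2$ on $\{\|x\|<1\}$ with $\tfrac12 I\preceq\nabla^2\phi(x)\preceq 2I$ there; 3. $\Phi$ is convex: $(1-\lambda)\phi+\lambda\psi\in\Phi$ for all $\phi,\psi\in\Phi$ and $\lambda\in[0,1]$; 4. $N(\varepsilon,\Phi)<\infty$ and $\log N(\varepsilon,\Phi)\le K\,\varepsilon^{-\gamma}\log(1+\varepsilon^{-1})$ for all $0<\varepsilon\le\varepsilon_0$; 5. $\mu$ satisfies the Poincaré inequality $\int\bigl(f-\int f\,d\mu\bigr)^2d\mu\le c\int\|\nabla f\|^2\,d\mu$ for all $C^1$ functions $f:\mathbb{R}^d\to\mathbb{R}$ in $L^2(\mu)$. Let $n\ge1$, let $X_1,\dots,X_n$ be i.i.d. with law $\mu$ and $Y_1,\dots,Y_n$ be i.i.d. with law $\nu$, and let $\widehat\varphi\in\Phi$ be a semidual estimator, i.e., almost surely a minimizer over $\phi\in\Phi$ of $$\mathcal S_n(\phi)=\frac1n\sum_{i=1}^n\phi(X_i)+\frac1n\sum_{j=1}^n\phi^*(Y_j).$$ **Theorem.** There is a constant $C>0$, depending only on $\gamma,R,K,\varepsilon_0,c,\rho$,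 such that in the above setting, for every $t\ge0$, $$\|\nabla\widehat\varphi-\nabla\varphi\|_{L^2(\mu)}^2\le C\left(\Bigl(\frac{\log n}{n}\Bigr)^{\frac{2}{2+\gamma}}+\frac{t+1}{n}\right)\quad\text{with probability at least }1-e^{-t},$$ and, for every $n\ge2$, $$\mathbb{E}\,\|\nabla\widehat\varphi-\nabla\varphi\|_{L^2(\mu)}^2\le C\Bigl(\frac{\log n}{n}\Bigr)^{\frac{2}{2+\gamma}}.$$ -/

import Mathlib

open MeasureTheory ProbabilityTheory

universe u

noncomputable section

namespace SemidualMap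

/-- The Euclidean space `ℝ^d`. -/
abbrev Space (d : ℕ) : Type := EuclideanSpace ℝ (Fin d)

/-- The domain `Ω`, the closed unit ball of `ℝ^d`. -/
def domain (d : ℕ) : Set (Space d) := Metric.closedBall 0 1

/-- The convex conjugate `φ^*(y) = sup_x {⟨x, y⟩ - φ(x)}` of an extended-real-valued function,
the supremum being over all of `ℝ^d`. -/
def conjugate {d : ℕ} (φ : Space d → EReal) (y : Space d) : EReal :=
  ⨆ x : Space d, ((inner ℝ x y : ℝ) : EReal) - φ x

/-- The finite part of an extended-real-valued function (only used where the function is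
finite). -/
def finitePart {d : ℕ} (φ : Space d → EReal) (x : Space d) : ℝ := (φ x).toReal

/-- The gradient `∇φ(x)` of an extended-real-valued function, at a point near which it is
finite and differentiable. -/
def grad {d : ℕ} (φ : Space d → EReal) (x : Space d) : Space d := gradient (finitePart φ) x

/-- The standing requirements on one potential: bounded by `R` on `Ω`, zero at the origin,
`+∞` off `Ω`, lower semicontinuous on `ℝ^d`, strongly convex on `Ω`, twice continuously
differentiable in the interior of `Ω`, with `(1/2) I ≼ ∇²φ(x) ≼ 2 I` there. -/
structure IsPotential {d : ℕ} (R : ℝ) (φ : Space d → EReal) : Prop where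
  bounded : ∀ x ∈ domain d, ((-R : ℝ) : EReal) ≤ φ x ∧ φ x ≤ (R : EReal)
  map_zero : φ 0 = 0
  eq_top : ∀ x, x ∉ domain d → φ x = ⊤
  lsc : LowerSemicontinuous φ
  strongConvex : StrongConvexOn (domain d) (1 / 2) (finitePart φ)
  contDiffOn : ContDiffOn ℝ 2 (finitePart φ) (Metric.ball 0 1)
  hessian : ∀ x ∈ Metric.ball (0 : Space d) 1, ∀ v : Space d,
    (1 / 2) * ‖v‖ ^ 2 ≤ fderiv ℝ (fderiv ℝ (finitePart φ)) x v v ∧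
      fderiv ℝ (fderiv ℝ (finitePart φ)) x v v ≤ 2 * ‖v‖ ^ 2

/-- `Φ` is closed under convex combinations (computed pointwise in the extended reals). -/
def IsConvexClass {d : ℕ} (Φ : Set (Space d → EReal)) : Prop :=
  ∀ φ ∈ Φ, ∀ ψ ∈ Φ, ∀ l : ℝ, 0 ≤ l → l ≤ 1 →
    (fun x => ((1 - l : ℝ) : EReal) * φ x + (l : EReal) * ψ x) ∈ Φ

/-- `F` is an `ε`-cover of `Φ` for the uniform norm on `Ω`; the centres need not lie in `Φ`. -/
def IsCover {d : ℕ} (ε : ℝ) (Φ : Set (Space d → EReal)) (F : Finset (Space d → ℝ)) : Prop :=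
  ∀ φ ∈ Φ, ∃ g ∈ F, ∀ x ∈ domain d, |finitePart φ x - g x| ≤ ε

/-- The covering number `N(ε, Φ)` for the uniform norm on `Ω` (`⊤` if there is no finite
cover). -/
def coveringNumber {d : ℕ} (ε : ℝ) (Φ : Set (Space d → EReal)) : ℕ∞ :=
  ⨅ (F : Finset (Space d → ℝ)) (_ : IsCover ε Φ F), (F.card : ℕ∞)

/-- For all `ε ∈ (0, ε₀]`, the covering number is finite and
`log N(ε, Φ) ≤ K ε^{-γ} log (1 + ε⁻¹)`. -/
def EntropyBound {d : ℕ} (γ K ε₀ : ℝ) (Φ : Set (Space d → EReal)) : Prop :=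
  ∀ ε : ℝ, 0 < ε → ε ≤ ε₀ → coveringNumber ε Φ ≠ ⊤ ∧
    Real.log ((coveringNumber ε Φ).toNat : ℝ) ≤ K * ε ^ (-γ) * Real.log (1 + ε⁻¹)

/-- The Poincaré inequality with constant `c`, tested on continuously differentiable functions
in `L²(P)`. -/
def Poincare {d : ℕ} (c : ℝ) (P : Measure (Space d)) : Prop :=
  ∀ f : Space d → ℝ, ContDiff ℝ 1 f → MemLp f 2 P →
    ∫⁻ x, ‖f x - ∫ z, f z ∂P‖ₑ ^ 2 ∂P ≤ ENNReal.ofReal c * ∫⁻ x, ‖gradient f x‖ₑ ^ 2 ∂P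

/-- The empirical semidual functional `∫ φ dμ_n + ∫ φ^* dν_n`, where `μ_n` and `ν_n` are the
empirical measures of the samples `x` and `y`. -/
def empiricalSemidual {d n : ℕ} (x y : Fin n → Space d) (φ : Space d → EReal) : EReal :=
  (((n : ℝ)⁻¹ : ℝ) : EReal) * (∑ i, φ (x i)) +
    (((n : ℝ)⁻¹ : ℝ) : EReal) * (∑ i, conjugate φ (y i))

/-- `φ` minimizes the empirical semidual functional over `Φ`. -/
def IsSemidualEstimator {d n : ℕ} (Φ : Set (Space d → EReal)) (x y : Fin n → Space d)
    (φ : Space d → EReal) : Prop :=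
  φ ∈ Φ ∧ ∀ ψ ∈ Φ, empiricalSemidual x y φ ≤ empiricalSemidual x y ψ

/-- The squared error `‖∇φ - ∇ψ‖²_{L²(μ)}`, as an extended nonnegative real. -/
def mapError {d : ℕ} (μ : Measure (Space d)) (φ ψ : Space d → EReal) : ENNReal :=
  ∫⁻ x, ‖grad φ x - grad ψ x‖ₑ ^ 2 ∂μ

/-- `Z 1, …, Z n` are independent random vectors with common law `P`. -/
def IsIIDSample {W : Type*} [MeasurableSpace W] (Pr : Measure W) {d n : ℕ}
    (Z : Fin n → W → Space d) (P : Measure (Space d)) : Prop :=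
  (∀ i, Measurable (Z i)) ∧ (∀ i, Pr.map (Z i) = P) ∧ iIndepFun Z Pr

end SemidualMap

end

/-! The excess semidual risk grows quadratically in the gradient error, and the variance of the
noise is controlled by the same quantity, so Bernstein's inequality gives a bound that can be
absorbed.

Let D be the squared gradient error of φ. The Fenchel–Young gap φ*(y) + φ(x) - ⟨x, y⟩ at y = ∇φ₀(x),
‖x‖ ≤ ρ, lies between `growth R ρ` * ‖∇φ - ∇φ₀‖² and ‖∇φ - ∇φ₀‖² (`le_gap`, `gap_le`), and its mean
is the excess risk of φ. Minimality of the estimator yields `growth_mul_gradDistSq_le_deviation`: a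
multiple of D is at most the sum of the empirical deviations of φ₀ - φ under μ and of φ₀* - φ* under
ν.

Both functions have variance O(D). For φ₀ - φ this is the Poincaré inequality. Along the graph of
∇φ₀, φ₀* - φ* equals -(φ₀ - φ) minus the gap, and the square of the gap is integrable with value
O(D), because gradients are bounded on the ball of radius ρ < 1.

Conjugation is a sup-norm contraction, so nets of Φ serve both classes. Chaining
(`exists_event_forall_deviation_le`) bounds every deviation by 2l * variance + C(l) * (r² + (t +
1)/n), where r = `rate γ n` balances the entropy r^(-γ) log n against n r². As l is free, it is
fixed so small that the variance terms are absorbed on the left; no localization is needed. The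
bound in expectation follows by integrating the tails. -/

noncomputable section

namespace SemidualMap

/-! ### Exponential moments and empirical means -/

section Concentration

variable {E W : Type*} [MeasurableSpace E] [MeasurableSpace W]

/-- The difference between the empirical mean of `h` over `z` and its mean under `P`. -/
def deviation (P : Measure E) {n : ℕ} (h : E → ℝ) (z : Fin n → E) : ℝ :=
  (n : ℝ)⁻¹ * ∑ i, h (z i) - ∫ x, h x ∂P

lemma integrable_of_abs_le {P : Measure E} [IsFiniteMeasure P] {h : E → ℝ} {B : ℝ}
    (hm : Measurable h) (hB : ∀ x, |h x| ≤ B) : Integrable h P :=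
  Integrable.of_bound hm.aestronglyMeasurable B (.of_forall hB)

lemma memLp_of_abs_le {P : Measure E} [IsFiniteMeasure P] {h : E → ℝ} {B : ℝ} {p : ENNReal}
    (hm : Measurable h) (hB : ∀ x, |h x| ≤ B) : MemLp h p P :=
  MemLp.of_bound hm.aestronglyMeasurable B (.of_forall hB)

lemma deviation_add (P : Measure E) {n : ℕ} {g h : E → ℝ} (hg : Integrable g P)
    (hh : Integrable h P) (z : Fin n → E) :
    deviation P (fun x => g x + h x) z = deviation P g z + deviation P h z := by
  simp only [deviation, integral_add hg hh, Finset.sum_add_distrib]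
  ring

lemma abs_integral_le_of_abs_le {P : Measure E} [IsProbabilityMeasure P] {h : E → ℝ} {B : ℝ}
    (hB : ∀ x, |h x| ≤ B) : |∫ x, h x ∂P| ≤ B := by
  simpa using norm_integral_le_of_norm_le_const (μ := P) (f := h) (C := B) (.of_forall hB)

lemma deviation_le_of_abs_le (P : Measure E) [IsProbabilityMeasure P] {n : ℕ} (hn : 1 ≤ n)
    {h : E → ℝ} {B : ℝ} (hB : ∀ x, |h x| ≤ B) (z : Fin n → E) : deviation P h z ≤ 2 * B := by
  have h1 := (abs_le.1 (abs_integral_le_of_abs_le (P := P) hB)).1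
  have h2 : ∑ i, h (z i) ≤ n * B := by
    simpa using Finset.sum_le_sum (s := Finset.univ) fun i _ => (abs_le.1 (hB (z i))).2
  have hn' : (0 : ℝ) < n := by exact_mod_cast hn
  have h3 : (n : ℝ)⁻¹ * ∑ i, h (z i) ≤ B := by
    rw [inv_mul_le_iff₀ hn']
    exact h2
  simp only [deviation]
  linarith

/-- Chernoff's bound for the empirical mean of an i.i.d. sample. -/
lemma measure_deviation_ge_le {Pr : Measure W} [IsProbabilityMeasure Pr] {P : Measure E}
    {n : ℕ} (hn : 1 ≤ n) {Z : Fin n → W → E} (hZ : ∀ i, Measurable (Z i))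
    (hZP : ∀ i, Pr.map (Z i) = P) (hind : iIndepFun Z Pr) {h : E → ℝ} {B : ℝ}
    (hm : Measurable h) (hB : ∀ x, |h x| ≤ B) {l v : ℝ} (hl : 0 < l)
    (hmgf : mgf (fun x => h x - ∫ x, h x ∂P) P l ≤ Real.exp v) (L : ℝ) :
    Pr {ω | (v + L / n) / l ≤ deviation P h (fun i => Z i ω)} ≤
      ENNReal.ofReal (Real.exp (-L)) := by
  have hn' : (0 : ℝ) < n := by exact_mod_cast hn
  set a := ∫ x, h x ∂P
  set X : Fin n → W → ℝ := fun i ω => h (Z i ω) - a with hX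
  have hXm : ∀ i, Measurable (X i) := fun i => (hm.comp (hZ i)).sub_const a
  have hXi : iIndepFun X Pr := hind.comp (fun _ x => h x - a) fun _ => hm.sub_const a
  have hmg : mgf (∑ i, X i) Pr l ≤ Real.exp (n * v) := by
    rw [hXi.mgf_sum hXm]
    have : ∀ i, mgf (X i) Pr l ≤ Real.exp v := by
      intro i
      refine le_trans (le_of_eq ?_) hmgf
      rw [← hZP i, mgf_map (hZ i).aemeasurable (by fun_prop)]
      rfl
    refine (Finset.prod_le_prod (fun i _ => mgf_nonneg) fun i _ => this i).trans (le_of_eq ?_)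
    simp [← Real.exp_nat_mul]
  have hSm : Measurable (∑ i, X i) := by
    have := Finset.measurable_sum Finset.univ fun i _ => hXm i
    convert this using 1
    ext ω
    simp
  have hint : Integrable (fun ω => Real.exp (l * (∑ i, X i) ω)) Pr := by
    refine Integrable.of_bound (C := Real.exp (l * (n * (B + |a|))))
      (by fun_prop) (.of_forall fun ω => ?_)
    rw [Real.norm_eq_abs, Real.abs_exp]
    gcongr
    rw [Finset.sum_apply]
    have h1 : ∀ i ∈ Finset.univ, X i ω ≤ B + |a| := fun i _ => by
      have h2 := (abs_le.1 (hB (Z i ω))).2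
      have h3 := neg_abs_le a
      simp only [hX]
      linarith
    simpa [mul_add] using Finset.sum_le_sum h1
  have key := measure_ge_le_exp_mul_mgf (μ := Pr) (X := ∑ i, X i) (n * ((v + L / n) / l)) hl.le
    hint
  have hset : {ω | (v + L / n) / l ≤ deviation P h (fun i => Z i ω)} =
      {ω | n * ((v + L / n) / l) ≤ (∑ i, X i) ω} := by
    ext ω
    have : (∑ i, X i) ω = n * deviation P h (fun i => Z i ω) := by
      simp only [Finset.sum_apply, hX, Finset.sum_sub_distrib, deviation, Finset.sum_const,
        Finset.card_univ, Fintype.card_fin, nsmul_eq_mul]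
      field_simp
      ring
    simp only [Set.mem_ofPred_eq, this]
    exact (mul_le_mul_iff_right₀ hn').symm
  rw [hset, ← ofReal_measureReal]
  refine ENNReal.ofReal_le_ofReal (key.trans ?_)
  refine (mul_le_mul_of_nonneg_left hmg (Real.exp_pos _).le).trans (le_of_eq ?_)
  rw [← Real.exp_add]
  congr 1
  field_simp
  ring

/-- Hoeffding's lemma, with its factor 1/2 discarded. -/
lemma mgf_sub_integral_le_exp_sq {P : Measure E} [IsProbabilityMeasure P] {h : E → ℝ} {b : ℝ}
    (hm : Measurable h) (hb : ∀ x, |h x| ≤ b) (l : ℝ) :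
    mgf (fun x => h x - ∫ x, h x ∂P) P l ≤ Real.exp ((l * b) ^ 2) := by
  have h1 := (hasSubgaussianMGF_of_mem_Icc (μ := P) (a := -b) (b := b) hm.aemeasurable
    (.of_forall fun x => abs_le.1 (hb x))).mgf_le l
  refine h1.trans (Real.exp_le_exp.2 ?_)
  have : (((‖b - -b‖₊ / 2) ^ 2 : NNReal) : ℝ) = b ^ 2 := by
    push_cast
    rw [Real.norm_eq_abs, div_pow, sq_abs]
    ring
  rw [this]
  nlinarith [sq_nonneg (l * b)]

/-- Integrate e^u ≤ 1 + u + u², valid for |u| ≤ 1, at u = l (h - E h): the linear term vanishes and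
the quadratic one is the variance. The condition on l keeps |u| ≤ 1. -/
lemma mgf_sub_integral_le_exp_variance {P : Measure E} [IsProbabilityMeasure P] {h : E → ℝ}
    {B : ℝ} (hm : Measurable h) (hB : ∀ x, |h x| ≤ B) {l : ℝ} (hl : 0 ≤ l)
    (hlB : l * (2 * B) ≤ 1) :
    mgf (fun x => h x - ∫ x, h x ∂P) P l ≤ Real.exp (l ^ 2 * variance h P) := by
  set a := ∫ x, h x ∂P with ha
  have hab : |a| ≤ B := abs_integral_le_of_abs_le hB
  have hint : Integrable h P := integrable_of_abs_le hm hB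
  have hc : ∀ x, |h x - a| ≤ 2 * B := fun x => by
    have := abs_sub (h x) a
    linarith [hB x]
  have hcm : Measurable fun x => h x - a := hm.sub_const a
  have hsq : Integrable (fun x => (h x - a) ^ 2) P := (memLp_of_abs_le hcm hc).integrable_sq
  have hpt : ∀ x, Real.exp (l * (h x - a)) ≤ 1 + l * (h x - a) + l ^ 2 * (h x - a) ^ 2 := by
    intro x
    have h1 : |l * (h x - a)| ≤ 1 := by
      rw [abs_mul, abs_of_nonneg hl]
      exact (mul_le_mul_of_nonneg_left (hc x) hl).trans hlB
    have h2 := (abs_le.1 (Real.abs_exp_sub_one_sub_id_le h1)).2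
    nlinarith
  have hl1 : Integrable (fun x => l * (h x - a)) P :=
    (hint.sub (integrable_const _)).const_mul l
  have hlin : Integrable (fun x => 1 + l * (h x - a)) P := (integrable_const _).add hl1
  calc mgf (fun x => h x - a) P l
      ≤ ∫ x, (1 + l * (h x - a) + l ^ 2 * (h x - a) ^ 2) ∂P := by
        refine integral_mono_of_nonneg (.of_forall fun x => (Real.exp_pos _).le)
          (hlin.add (hsq.const_mul _)) (.of_forall hpt)
    _ = 1 + l ^ 2 * variance h P := by
        rw [integral_add hlin (hsq.const_mul _), integral_add (integrable_const _) hl1,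
          integral_const_mul, integral_const_mul,
          integral_sub hint (integrable_const _), variance_eq_integral hm.aemeasurable]
        simp [ha]
    _ ≤ _ := by
        have := Real.add_one_le_exp (l ^ 2 * variance h P)
        linarith

lemma variance_le_two_mul_add {P : Measure E} [IsProbabilityMeasure P] {g h : E → ℝ} {B B' : ℝ}
    (hg : Measurable g) (hgB : ∀ x, |g x| ≤ B) (hh : Measurable h) (hhB : ∀ x, |h x| ≤ B') :
    variance g P ≤ 2 * ∫ x, (g x - h x) ^ 2 ∂P + 2 * variance h P := by
  set a := ∫ x, h x ∂P with ha
  have hab : |a| ≤ B' := abs_integral_le_of_abs_le hhB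
  have h1 : ∀ x, |g x - h x| ≤ B + B' := fun x => by
    have := abs_sub (g x) (h x)
    linarith [hgB x, hhB x]
  have h2 : ∀ x, |h x - a| ≤ 2 * B' := fun x => by
    have := abs_sub (h x) a
    linarith [hhB x]
  have i1 : Integrable (fun x => (g x - h x) ^ 2) P :=
    (memLp_of_abs_le (hg.sub hh) h1).integrable_sq
  have i2 : Integrable (fun x => (h x - a) ^ 2) P :=
    (memLp_of_abs_le (hh.sub_const a) h2).integrable_sq
  rw [← variance_sub_const hg.aestronglyMeasurable a, variance_eq_integral hh.aemeasurable,
    ← integral_const_mul, ← integral_const_mul, ← integral_add (i1.const_mul _) (i2.const_mul _)]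
  refine (variance_le_expectation_sq (hg.sub_const a).aestronglyMeasurable).trans ?_
  refine integral_mono_of_nonneg (.of_forall fun x => sq_nonneg _)
    ((i1.const_mul _).add (i2.const_mul _)) (.of_forall fun x => ?_)
  simp only [Pi.pow_apply, ha]
  nlinarith [sq_nonneg ((g x - h x) - (h x - a)), ha]

end Concentration

/-! ### Uniform deviation bounds by chaining -/

section Chaining

variable {E W : Type*} [MeasurableSpace E] [MeasurableSpace W]

lemma measure_biUnion_le_exp {ι : Type*} {Pr : Measure W} (S : Finset ι) (D : ι → Set W)
    {H L : ℝ} (hS : (S.card : ℝ) ≤ Real.exp H)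
    (hD : ∀ i ∈ S, Pr (D i) ≤ ENNReal.ofReal (Real.exp (-(H + L)))) :
    Pr (⋃ i ∈ S, D i) ≤ ENNReal.ofReal (Real.exp (-L)) := by
  refine (measure_biUnion_finset_le S D).trans ((Finset.sum_le_sum hD).trans ?_)
  rw [Finset.sum_const, nsmul_eq_mul, ← ENNReal.ofReal_natCast,
    ← ENNReal.ofReal_mul (by positivity)]
  refine ENNReal.ofReal_le_ofReal ?_
  calc (S.card : ℝ) * Real.exp (-(H + L)) ≤ Real.exp H * Real.exp (-(H + L)) := by gcongr
    _ = Real.exp (-L) := by rw [← Real.exp_add]; congr 1; ring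

/-- Simultaneous Hoeffding bound over a finite family, in linearized form. -/
lemma exists_event_deviation_le_of_abs_le {ι : Type*} {Pr : Measure W} [IsProbabilityMeasure Pr]
    {P : Measure E} [IsProbabilityMeasure P] {n : ℕ} (hn : 1 ≤ n) {Z : Fin n → W → E}
    (hZ : ∀ i, Measurable (Z i)) (hZP : ∀ i, Pr.map (Z i) = P) (hind : iIndepFun Z Pr)
    (S : Finset ι) (h : ι → E → ℝ) (hm : ∀ i, Measurable (h i)) {b x H : ℝ} (hb : 0 < b)
    (hx : 0 < x) (hh : ∀ i ∈ S, ∀ z, |h i z| ≤ b) (hS : (S.card : ℝ) ≤ Real.exp H) (L : ℝ) :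
    ∃ D : Set W, Pr D ≤ ENNReal.ofReal (Real.exp (-L)) ∧ ∀ ω ∉ D, ∀ i ∈ S,
      deviation P (h i) (fun j => Z j ω) ≤ b * x + b * ((H + L) / n) / x := by
  -- Chernoff's bound at l = x / b, where the exponent (l b)² is x²; the parameter x remains free
  -- for each link of the chain.
  refine ⟨_, measure_biUnion_le_exp S _ hS fun i hi => measure_deviation_ge_le hn hZ hZP hind
    (hm i) (hh i hi) (div_pos hx hb) (mgf_sub_integral_le_exp_sq (hm i) (hh i hi) _) (H + L), ?_⟩
  intro ω hω i hi
  simp only [Set.mem_iUnion, Set.mem_ofPred_eq, not_exists, not_le] at hω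
  refine (hω i hi).le.trans (le_of_eq ?_)
  field_simp

/-- Simultaneous Bernstein bound over a finite family, in linearized form. -/
lemma exists_event_deviation_le_variance {ι : Type*} {Pr : Measure W} [IsProbabilityMeasure Pr]
    {P : Measure E} [IsProbabilityMeasure P] {n : ℕ} (hn : 1 ≤ n) {Z : Fin n → W → E}
    (hZ : ∀ i, Measurable (Z i)) (hZP : ∀ i, Pr.map (Z i) = P) (hind : iIndepFun Z Pr)
    (S : Finset ι) (h : ι → E → ℝ) (hm : ∀ i, Measurable (h i)) {B l H : ℝ}
    (hh : ∀ i, ∀ z, |h i z| ≤ B) (hl : 0 < l) (hlB : l * (2 * B) ≤ 1)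
    (hS : (S.card : ℝ) ≤ Real.exp H) (L : ℝ) :
    ∃ D : Set W, Pr D ≤ ENNReal.ofReal (Real.exp (-L)) ∧ ∀ ω ∉ D, ∀ i ∈ S,
      deviation P (h i) (fun j => Z j ω) ≤ l * variance (h i) P + (H + L) / n / l := by
  refine ⟨_, measure_biUnion_le_exp S _ hS fun i hi => measure_deviation_ge_le hn hZ hZP hind
    (hm i) (hh i) hl (mgf_sub_integral_le_exp_variance (hm i) (hh i) hl.le hlB) (H + L), ?_⟩
  intro ω hω i hi
  simp only [Set.mem_iUnion, Set.mem_ofPred_eq, not_exists, not_le] at hω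
  refine (hω i hi).le.trans (le_of_eq ?_)
  field_simp

lemma sum_exp_neg_le (t : ℝ) (j : ℕ) :
    ∑ k ∈ Finset.range j, Real.exp (-(t + k + 1)) ≤ Real.exp (-t) * (1 - (1 / 2) ^ j) := by
  have he : Real.exp (-1) ≤ 1 / 2 := by
    rw [Real.exp_neg, one_div]
    exact inv_anti₀ (by norm_num) (by linarith [Real.add_one_le_exp (1 : ℝ)])
  induction j with
  | zero => simp
  | succ j ih =>
    rw [Finset.sum_range_succ]
    have h1 : Real.exp (-(t + j + 1)) = Real.exp (-t) * Real.exp (-1) ^ (j + 1) := by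
      rw [← Real.exp_nat_mul, ← Real.exp_add]
      congr 1
      push_cast
      ring
    have h2 : Real.exp (-1) ^ (j + 1) ≤ (1 / 2) ^ (j + 1) := by gcongr
    have h3 := mul_le_mul_of_nonneg_left h2 (Real.exp_pos (-t)).le
    have h4 : ((1 : ℝ) / 2) ^ j = 2 * (1 / 2) ^ (j + 1) := by ring
    rw [h1]
    rw [h4] at ih
    linarith

/-- Uniform deviation bound by chaining along nets at the scales `r 2^{-k}`, whose cardinalities
grow at most like `exp (A n r² 2^k)`: Bernstein's bound at the coarsest scale, Hoeffding's bound
along the links. -/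
theorem exists_event_forall_deviation_le {T : Type*} {Pr : Measure W} [IsProbabilityMeasure Pr]
    {P : Measure E} [IsProbabilityMeasure P] {n : ℕ} (hn : 1 ≤ n) {Z : Fin n → W → E}
    (hZ : ∀ i, Measurable (Z i)) (hZP : ∀ i, Pr.map (Z i) = P) (hind : iIndepFun Z Pr)
    (f : T → E → ℝ) (hm : ∀ s, Measurable (f s)) {B l r A t : ℝ} (hB : ∀ s z, |f s z| ≤ B)
    (hl : 0 < l) (hlB : l * (2 * B) ≤ 1) (hr : 0 < r) (ht : 0 ≤ t) {m : ℕ}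
    (F : ℕ → Finset T)
    (hF : ∀ k ≤ m, ∀ s, ∃ u ∈ F k, ∀ z, |f s z - f u z| ≤ r * (1 / 2) ^ k)
    (hcard : ∀ k ≤ m, ((F k).card : ℝ) ≤ Real.exp (A * n * r ^ 2 * 2 ^ k)) :
    ∃ D : Set W, Pr D ≤ ENNReal.ofReal (Real.exp (-t)) ∧ ∀ ω ∉ D, ∀ s,
      deviation P (f s) (fun j => Z j ω) ≤ 2 * l * variance (f s) P + 2 * l * r ^ 2 +
        (A * r ^ 2 + (t + 1) / n) / l + (8 + 18 * |A|) * r ^ 2 + 9 * (t + 1) / n +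
          2 * (r * (1 / 2) ^ m) := by
  classical
  have hn' : (0 : ℝ) < n := by exact_mod_cast hn
  have hint : ∀ s, Integrable (f s) P := fun s => integrable_of_abs_le (hm s) (hB s)
  obtain ⟨D0, hD0, hD0'⟩ := exists_event_deviation_le_variance hn hZ hZP hind (F 0) f hm hB hl hlB
    (H := A * n * r ^ 2) (by simpa using hcard 0 (Nat.zero_le _)) (t + 1)
  let link : T × T → E → ℝ := fun p z => f p.1 z - f p.2 z
  -- Only close pairs are kept, so that Hoeffding's bound sees the link size 2 r 2^(-k).
  let S : ℕ → Finset (T × T) := fun k =>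
    (F (k + 1) ×ˢ F k).filter fun p => ∀ z, |link p z| ≤ 2 * (r * (1 / 2) ^ k)
  have hS : ∀ k, k + 1 ≤ m → ((S k).card : ℝ) ≤ Real.exp (3 * A * n * r ^ 2 * 2 ^ k) := by
    intro k hk
    have h1 : (S k).card ≤ (F (k + 1)).card * (F k).card := by
      rw [← Finset.card_product]
      exact Finset.card_filter_le _ _
    calc ((S k).card : ℝ) ≤ (F (k + 1)).card * (F k).card := by exact_mod_cast h1
      _ ≤ Real.exp (A * n * r ^ 2 * 2 ^ (k + 1)) * Real.exp (A * n * r ^ 2 * 2 ^ k) := by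
        gcongr
        · exact hcard _ hk
        · exact hcard _ (by omega)
      _ = _ := by
        rw [← Real.exp_add]
        congr 1
        ring
  -- With x = r (3/2)^k, the two Hoeffding terms decay like r² (3/4)^k and A r² (2/3)^k. The level t
  -- + k + 2 makes the failure probabilities summable to at most e^(-t), level t + 1 being spent on
  -- the coarsest net.
  have hlink : ∀ k, ∃ D : Set W, k + 1 ≤ m → Pr D ≤ ENNReal.ofReal (Real.exp (-(t + k + 1 + 1))) ∧
      ∀ ω ∉ D, ∀ p ∈ S k, deviation P (link p) (fun j => Z j ω) ≤
        2 * (r * (1 / 2) ^ k) * (r * (3 / 2) ^ k) + 2 * (r * (1 / 2) ^ k) *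
          ((3 * A * n * r ^ 2 * 2 ^ k + (t + k + 1 + 1)) / n) / (r * (3 / 2) ^ k) := by
    intro k
    by_cases hk : k + 1 ≤ m
    · obtain ⟨D, h⟩ := exists_event_deviation_le_of_abs_le hn hZ hZP hind (S k) link
        (fun p => (hm p.1).sub (hm p.2)) (b := 2 * (r * (1 / 2) ^ k)) (x := r * (3 / 2) ^ k)
        (by positivity) (by positivity) (fun p hp => (Finset.mem_filter.1 hp).2) (hS k hk)
        (t + k + 1 + 1)
      exact ⟨D, fun _ => h⟩
    · exact ⟨∅, fun h => absurd h hk⟩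
  choose D hD using hlink
  let D' : ℕ → Set W := fun k => Nat.casesOn k D0 D
  refine ⟨⋃ k ∈ Finset.range (m + 1), D' k, ?_, ?_⟩
  · refine (measure_biUnion_finset_le _ _).trans ?_
    have h1 : ∀ k ∈ Finset.range (m + 1),
        Pr (D' k) ≤ ENNReal.ofReal (Real.exp (-(t + k + 1))) := by
      intro k hk
      rcases k with _ | k
      · simpa [D'] using hD0
      · have := (hD k (by simpa [Nat.succ_le_iff] using hk)).1
        simpa [D', add_assoc] using this
    refine (Finset.sum_le_sum h1).trans ?_
    rw [← ENNReal.ofReal_sum_of_nonneg fun k _ => (Real.exp_pos _).le]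
    refine ENNReal.ofReal_le_ofReal ((sum_exp_neg_le t (m + 1)).trans ?_)
    exact mul_le_of_le_one_right (Real.exp_pos _).le (by simp)
  · intro ω hω s
    simp only [Set.mem_iUnion, not_exists] at hω
    have hω0 : ω ∉ D0 := hω 0 (by simp)
    have hωk : ∀ k, k + 1 ≤ m → ω ∉ D k := fun k hk => hω (k + 1) (by simpa using by omega)
    have hF' : ∀ k, ∃ u, k ≤ m → u ∈ F k ∧ ∀ z, |f s z - f u z| ≤ r * (1 / 2) ^ k := by
      intro k
      by_cases hk : k ≤ m
      · obtain ⟨u, hu⟩ := hF k hk s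
        exact ⟨u, fun _ => hu⟩
      · exact ⟨s, fun h => absurd h hk⟩
    choose q hq using hF'
    set z : Fin n → E := fun j => Z j ω
    -- The decrements of U dominate the link bounds, so the chain telescopes instead of requiring a
    -- summation of series.
    let U : ℕ → ℝ := fun k => 8 * r ^ 2 * (3 / 4) ^ k + 18 * |A| * r ^ 2 * (2 / 3) ^ k +
      (3 * (t + 1) * (1 / 3) ^ k + 6 * (2 / 3) ^ k) / n
    have hstep : ∀ k, k + 1 ≤ m → deviation P (link (q (k + 1), q k)) z ≤ U k - U (k + 1) := by
      intro k hk
      have hmem : (q (k + 1), q k) ∈ S k := by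
        refine Finset.mem_filter.2 ⟨Finset.mk_mem_product (hq _ hk).1 (hq k (by omega)).1, ?_⟩
        intro z
        have h1 := (hq _ hk).2 z
        have h2 := (hq k (by omega)).2 z
        have h3 : r * (1 / 2 : ℝ) ^ (k + 1) ≤ r * (1 / 2) ^ k := by
          gcongr ?_ * ?_
          exact pow_le_pow_of_le_one (by norm_num) (by norm_num) (Nat.le_succ k)
        simp only [link]
        rw [abs_le] at *
        constructor <;> linarith
      refine ((hD k hk).2 ω (hωk k hk) _ hmem).trans ?_
      have e1 : ((1 : ℝ) / 2) ^ k * (3 / 2) ^ k = (3 / 4) ^ k := by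
        rw [← mul_pow]; norm_num
      have e2 : ((1 : ℝ) / 2) ^ k = (1 / 3) ^ k * (3 / 2) ^ k := by
        rw [← mul_pow]; norm_num
      have e3 : ((1 : ℝ) / 3) ^ k * 2 ^ k = (2 / 3) ^ k := by
        rw [← mul_pow]; norm_num
      have p32 : (0 : ℝ) < (3 / 2) ^ k := by positivity
      -- Turns the linear growth of the confidence level, weighted by (1/3)^k, into (2/3)^k.
      have hk2 : ((k : ℝ) + 1) ≤ 2 ^ k := by exact_mod_cast Nat.lt_two_pow_self
      have e4 : 2 * (r * (1 / 2) ^ k) * (r * (3 / 2) ^ k) + 2 * (r * (1 / 2) ^ k) *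
          ((3 * A * n * r ^ 2 * 2 ^ k + (t + k + 1 + 1)) / n) / (r * (3 / 2) ^ k) =
          2 * r ^ 2 * (3 / 4) ^ k + 6 * A * r ^ 2 * (2 / 3) ^ k +
            2 * (1 / 3) ^ k * (t + 1 + (k + 1)) / n := by
        rw [← e3, ← e1, e2]
        field_simp
        ring
      have e5 : U k - U (k + 1) = 2 * r ^ 2 * (3 / 4) ^ k + 6 * |A| * r ^ 2 * (2 / 3) ^ k +
          (2 * (1 / 3) ^ k * (t + 1) + 2 * (2 / 3) ^ k) / n := by
        simp only [U, pow_succ]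
        field_simp
        ring
      rw [e4, e5, ← e3]
      gcongr
      · exact le_abs_self A
      · nlinarith [mul_le_mul_of_nonneg_left hk2 (by positivity : (0 : ℝ) ≤ (1 / 3) ^ k)]
    have hchain : ∀ k ≤ m, deviation P (f (q k)) z ≤ deviation P (f (q 0)) z + U 0 - U k := by
      intro k
      induction k with
      | zero => intro _; simp
      | succ k ih =>
        intro hk
        have h1 := ih (by omega)
        have h2 := hstep k hk
        have h3 := deviation_add P (n := n) (hint (q k))
          ((hint (q (k + 1))).sub (hint (q k))) z
        simp only [Pi.sub_apply, add_sub_cancel] at h3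
        rw [h3]
        have h4 : deviation P (f (q (k + 1)) - f (q k)) z = deviation P (link (q (k + 1), q k)) z :=
          rfl
        rw [h4]
        linarith
    have hlast : deviation P (f s) z ≤ deviation P (f (q m)) z + 2 * (r * (1 / 2) ^ m) := by
      have h3 := deviation_add P (n := n) (hint (q m)) ((hint s).sub (hint (q m))) z
      simp only [Pi.sub_apply, add_sub_cancel] at h3
      rw [h3]
      gcongr
      exact deviation_le_of_abs_le P hn (hq m le_rfl).2 z
    have hbase := hD0' ω hω0 (q 0) (hq 0 (Nat.zero_le _)).1
    -- Bernstein's bound involves the variance at the net point; this transfers it to f s at the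
    -- cost of r².
    have hvar : variance (f (q 0)) P ≤ 2 * r ^ 2 + 2 * variance (f s) P := by
      have hsq : ∀ x, (f (q 0) x - f s x) ^ 2 ≤ r ^ 2 := fun x => by
        have := (hq 0 (Nat.zero_le _)).2 x
        rw [pow_zero, mul_one, abs_sub_comm] at this
        exact sq_le_sq' (by linarith [(abs_le.1 this).1]) (abs_le.1 this).2
      refine (variance_le_two_mul_add (hm _) (hB _) (hm s) (hB s)).trans ?_
      have : ∫ x, (f (q 0) x - f s x) ^ 2 ∂P ≤ r ^ 2 := by
        have := integral_mono_of_nonneg (μ := P) (.of_forall fun x => sq_nonneg (f (q 0) x - f s x))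
          (integrable_const (r ^ 2)) (.of_forall hsq)
        simpa using this
      linarith
    have hm' := hchain m le_rfl
    have hUm : 0 ≤ U m := by positivity
    have hU0 : U 0 ≤ (8 + 18 * |A|) * r ^ 2 + 9 * (t + 1) / n := by
      have : 6 / (n : ℝ) ≤ 6 * (t + 1) / n := by
        gcongr
        linarith
      simp only [U, pow_zero, mul_one]
      have h2 : (3 * (t + 1) + 6) / (n : ℝ) = 3 * (t + 1) / n + 6 / n := by ring
      have h3 : 9 * (t + 1) / (n : ℝ) = 3 * (t + 1) / n + 6 * (t + 1) / n := by ring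
      rw [h2, h3]
      linarith
    have hb2 : (A * n * r ^ 2 + (t + 1)) / n / l = (A * r ^ 2 + (t + 1) / n) / l := by
      field_simp
    rw [hb2] at hbase
    have hv := mul_le_mul_of_nonneg_left hvar hl.le
    have hb3 : deviation P (f (q 0)) z ≤ l * variance (f (q 0)) P +
      (A * r ^ 2 + (t + 1) / n) / l := hbase
    linarith

end Chaining

/-! ### First-order estimates for potentials -/

section Potential

open Filter Topology

variable {d : ℕ} {R : ℝ} {φ ψ : Space d → EReal}

lemma zero_mem_domain (d : ℕ) : (0 : Space d) ∈ domain d := by simp [domain]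

lemma ball_subset_domain (d : ℕ) : Metric.ball (0 : Space d) 1 ⊆ domain d :=
  Metric.ball_subset_closedBall

namespace IsPotential

lemma coe_finitePart (hφ : IsPotential R φ) {x : Space d} (hx : x ∈ domain d) :
    (finitePart φ x : EReal) = φ x := by
  have h := hφ.bounded x hx
  refine EReal.coe_toReal (ne_top_of_le_ne_top (EReal.coe_ne_top R) h.2) ?_
  exact ne_bot_of_le_ne_bot (EReal.coe_ne_bot _) h.1

lemma abs_finitePart_le (hφ : IsPotential R φ) {x : Space d} (hx : x ∈ domain d) :
    |finitePart φ x| ≤ R := by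
  have h := hφ.bounded x hx
  rw [← hφ.coe_finitePart hx, EReal.coe_le_coe_iff, EReal.coe_le_coe_iff] at h
  exact abs_le.2 h

lemma nonneg (hφ : IsPotential R φ) : 0 ≤ R :=
  (abs_nonneg _).trans (hφ.abs_finitePart_le (zero_mem_domain d))

lemma contDiffAt (hφ : IsPotential R φ) {x : Space d} (hx : x ∈ Metric.ball (0 : Space d) 1) :
    ContDiffAt ℝ 2 (finitePart φ) x :=
  hφ.contDiffOn.contDiffAt (Metric.isOpen_ball.mem_nhds hx)

lemma differentiableAt (hφ : IsPotential R φ) {x : Space d}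
    (hx : x ∈ Metric.ball (0 : Space d) 1) : DifferentiableAt ℝ (finitePart φ) x :=
  (hφ.contDiffAt hx).differentiableAt (by norm_num)

lemma inner_grad (φ : Space d → EReal) (x v : Space d) :
    inner ℝ (grad φ x) v = fderiv ℝ (finitePart φ) x v := by
  simp [grad, gradient]

lemma hasDerivAt_line (hφ : IsPotential R φ) {x v : Space d} {t : ℝ}
    (hx : x + t • v ∈ Metric.ball (0 : Space d) 1) :
    HasDerivAt (fun s : ℝ => finitePart φ (x + s • v))
      (fderiv ℝ (finitePart φ) (x + t • v) v) t := by
  have h1 : HasDerivAt (fun s : ℝ => x + s • v) v t := by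
    simpa using ((hasDerivAt_id t).smul_const v).const_add x
  exact (hφ.differentiableAt hx).hasFDerivAt.comp_hasDerivAt t h1

lemma hasDerivAt_fderiv_line (hφ : IsPotential R φ) {x v : Space d} {t : ℝ}
    (hx : x + t • v ∈ Metric.ball (0 : Space d) 1) :
    HasDerivAt (fun s : ℝ => fderiv ℝ (finitePart φ) (x + s • v) v)
      (fderiv ℝ (fderiv ℝ (finitePart φ)) (x + t • v) v v) t := by
  have h1 : HasDerivAt (fun s : ℝ => x + s • v) v t := by
    simpa using ((hasDerivAt_id t).smul_const v).const_add x
  have h2 : DifferentiableAt ℝ (fderiv ℝ (finitePart φ)) (x + t • v) :=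
    ((hφ.contDiffAt hx).fderiv_right (m := 1) (by norm_num)).differentiableAt (by norm_num)
  have h3 := h2.hasFDerivAt.comp_hasDerivAt t h1
  simpa using h3.clm_apply (hasDerivAt_const t v)

/-- First-order lower bound coming from strong convexity. -/
lemma inner_grad_add_le (hφ : IsPotential R φ) {x x' : Space d}
    (hx : x ∈ Metric.ball (0 : Space d) 1) (hx' : x' ∈ domain d) :
    inner ℝ (grad φ x) (x' - x) + 1 / 4 * ‖x' - x‖ ^ 2 ≤ finitePart φ x' - finitePart φ x := by
  set v := x' - x with hv
  have h0 : x + (0 : ℝ) • v ∈ Metric.ball (0 : Space d) 1 := by simpa using hx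
  -- Strong convexity is divided by t and t tends to 0 from the right. Differentiability is used
  -- only at x, so x' may lie on the unit sphere.
  have h1 := (hφ.hasDerivAt_line h0).tendsto_slope_zero_right
  simp only [zero_add, zero_smul, add_zero] at h1
  have h2 : Tendsto (fun t : ℝ => finitePart φ x' - finitePart φ x - (1 - t) * (1 / 4 * ‖v‖ ^ 2))
      (𝓝[>] 0) (𝓝 (finitePart φ x' - finitePart φ x - (1 - 0) * (1 / 4 * ‖v‖ ^ 2))) := by
    refine Tendsto.mono_left (Continuous.tendsto ?_ 0) nhdsWithin_le_nhds
    fun_prop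
  have h3 := le_of_tendsto_of_tendsto h1 h2 ?_
  · rw [inner_grad]
    linarith
  · filter_upwards [Ioo_mem_nhdsGT (zero_lt_one (α := ℝ))] with t ht
    have h4 := (show UniformConvexOn (domain d) (fun r => 1 / 2 / 2 * r ^ 2) (finitePart φ) from
      hφ.strongConvex).2 (ball_subset_domain d hx) hx' (by linarith [ht.2] : 0 ≤ 1 - t) ht.1.le
      (by ring)
    have h5 : (1 - t) • x + t • x' = x + t • v := by
      rw [hv]
      module
    rw [h5, norm_sub_rev, ← hv] at h4
    simp only [smul_eq_mul] at h4 ⊢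
    rw [inv_mul_le_iff₀ ht.1]
    linarith

/-- First-order upper bound coming from the Hessian bound. -/
lemma finitePart_add_le (hφ : IsPotential R φ) {x v : Space d}
    (hx : x ∈ Metric.ball (0 : Space d) 1) (hv : x + v ∈ Metric.ball (0 : Space d) 1) :
    finitePart φ (x + v) ≤ finitePart φ x + inner ℝ (grad φ x) v + ‖v‖ ^ 2 := by
  have hline : ∀ t ∈ Set.Icc (0 : ℝ) 1, x + t • v ∈ Metric.ball (0 : Space d) 1 := by
    intro t ht
    have := (convex_ball (0 : Space d) 1) hx hv (a := 1 - t) (b := t) (by linarith [ht.2]) ht.1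
      (by ring)
    convert this using 1
    module
  set a := fderiv ℝ (finitePart φ) x v with ha
  -- The Hessian bound is integrated twice along the segment, each time as a monotonicity statement.
  have hslope : MonotoneOn (fun t : ℝ => 2 * ‖v‖ ^ 2 * t -
      fderiv ℝ (finitePart φ) (x + t • v) v) (Set.Icc 0 1) := by
    have hd : ∀ t ∈ Set.Icc (0 : ℝ) 1, HasDerivAt (fun t : ℝ => 2 * ‖v‖ ^ 2 * t -
        fderiv ℝ (finitePart φ) (x + t • v) v)
        (2 * ‖v‖ ^ 2 * 1 - fderiv ℝ (fderiv ℝ (finitePart φ)) (x + t • v) v v) t := fun t ht =>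
      ((hasDerivAt_id t).const_mul _).sub (hφ.hasDerivAt_fderiv_line (hline t ht))
    refine monotoneOn_of_hasDerivWithinAt_nonneg (convex_Icc 0 1)
      (fun t ht => (hd t ht).continuousAt.continuousWithinAt)
      (fun t ht => (hd t (interior_subset ht)).hasDerivWithinAt) fun t ht => ?_
    linarith [(hφ.hessian _ (hline t (interior_subset ht)) v).2]
  have hval : MonotoneOn (fun t : ℝ => a * t + ‖v‖ ^ 2 * t ^ 2 - finitePart φ (x + t • v))
      (Set.Icc 0 1) := by
    have hd : ∀ t ∈ Set.Icc (0 : ℝ) 1, HasDerivAt (fun t : ℝ => a * t + ‖v‖ ^ 2 * t ^ 2 -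
        finitePart φ (x + t • v))
        (a * 1 + ‖v‖ ^ 2 * (2 * t) - fderiv ℝ (finitePart φ) (x + t • v) v) t := fun t ht => by
      refine (((hasDerivAt_id t).const_mul _).add ?_).sub (hφ.hasDerivAt_line (hline t ht))
      simpa using (hasDerivAt_pow 2 t).const_mul (‖v‖ ^ 2)
    refine monotoneOn_of_hasDerivWithinAt_nonneg (convex_Icc 0 1)
      (fun t ht => (hd t ht).continuousAt.continuousWithinAt)
      (fun t ht => (hd t (interior_subset ht)).hasDerivWithinAt) fun t ht => ?_
    have ht' := interior_subset ht
    have := hslope (Set.left_mem_Icc.2 zero_le_one) ht' ht'.1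
    simp only [mul_zero, zero_smul, add_zero, ← ha] at this
    linarith
  have := hval (Set.left_mem_Icc.2 zero_le_one) (Set.right_mem_Icc.2 zero_le_one) zero_le_one
  simp only [mul_zero, zero_smul, add_zero, one_smul, mul_one, one_pow] at this
  rw [inner_grad, ← ha]
  linarith

/-- A step of length 1 - ρ along the gradient stays in Ω, and by convexity raises φ by at least (1 -
ρ) ‖∇φ(x)‖, while φ varies by at most 2R. -/
lemma norm_grad_le (hφ : IsPotential R φ) {ρ : ℝ} (hρ : ρ < 1) {x : Space d}
    (hx : x ∈ Metric.closedBall (0 : Space d) ρ) : ‖grad φ x‖ ≤ 2 * R / (1 - ρ) := by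
  have hρ' : 0 < 1 - ρ := by linarith
  have hx1 : x ∈ Metric.ball (0 : Space d) 1 := Metric.closedBall_subset_ball hρ hx
  rcases eq_or_ne (grad φ x) 0 with h0 | h0
  · rw [h0, norm_zero]
    have := hφ.nonneg
    positivity
  have hpos : 0 < ‖grad φ x‖ := norm_pos_iff.2 h0
  set v := ((1 - ρ) / ‖grad φ x‖) • grad φ x with hv
  have hvn : ‖v‖ = 1 - ρ := by
    rw [hv, norm_smul, norm_div, norm_norm, Real.norm_of_nonneg hρ'.le]
    field_simp
  have hxv : x + v ∈ domain d := by
    rw [domain, mem_closedBall_zero_iff]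
    have := norm_add_le x v
    rw [mem_closedBall_zero_iff] at hx
    linarith
  have h1 := hφ.inner_grad_add_le hx1 hxv
  rw [add_sub_cancel_left] at h1
  have h2 : inner ℝ (grad φ x) v = (1 - ρ) * ‖grad φ x‖ := by
    rw [hv, real_inner_smul_right, real_inner_self_eq_norm_sq]
    field_simp
  have h3 := (abs_le.1 (hφ.abs_finitePart_le hxv)).2
  have h4 := (abs_le.1 (hφ.abs_finitePart_le (ball_subset_domain d hx1))).1
  rw [le_div_iff₀ hρ', mul_comm, ← h2]
  nlinarith [sq_nonneg ‖v‖]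

end IsPotential

/-! ### Conjugates and the Fenchel–Young gap -/

/-- The convex conjugate as a real-valued function. -/
def conj (φ : Space d → EReal) (y : Space d) : ℝ := (conjugate φ y).toReal

namespace IsPotential

lemma conjugate_le (hφ : IsPotential R φ) {y : Space d} {M : ℝ}
    (h : ∀ x ∈ domain d, inner ℝ x y - finitePart φ x ≤ M) : conjugate φ y ≤ (M : EReal) := by
  refine iSup_le fun x => ?_
  by_cases hx : x ∈ domain d
  · rw [← hφ.coe_finitePart hx]
    exact_mod_cast h x hx
  · simp [hφ.eq_top x hx]

lemma le_conjugate (hφ : IsPotential R φ) {x : Space d} (hx : x ∈ domain d) (y : Space d) :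
    ((inner ℝ x y - finitePart φ x : ℝ) : EReal) ≤ conjugate φ y := by
  rw [EReal.coe_sub, hφ.coe_finitePart hx]
  exact le_iSup (fun x : Space d => ((inner ℝ x y : ℝ) : EReal) - φ x) x

lemma coe_conj (hφ : IsPotential R φ) (y : Space d) : (conj φ y : EReal) = conjugate φ y := by
  refine EReal.coe_toReal (ne_top_of_le_ne_top (EReal.coe_ne_top (‖y‖ + R)) ?_) ?_
  · refine hφ.conjugate_le fun x hx => ?_
    have h1 := (abs_le.1 (hφ.abs_finitePart_le hx)).1
    have h2 := real_inner_le_norm x y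
    have h3 : ‖x‖ ≤ 1 := mem_closedBall_zero_iff.1 hx
    nlinarith [norm_nonneg y]
  · exact ne_bot_of_le_ne_bot (EReal.coe_ne_bot _) (hφ.le_conjugate (zero_mem_domain d) y)

lemma conj_le (hφ : IsPotential R φ) {y : Space d} {M : ℝ}
    (h : ∀ x ∈ domain d, inner ℝ x y - finitePart φ x ≤ M) : conj φ y ≤ M := by
  have := hφ.conjugate_le h
  rw [← hφ.coe_conj] at this
  exact_mod_cast this

lemma le_conj (hφ : IsPotential R φ) {x : Space d} (hx : x ∈ domain d) (y : Space d) :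
    inner ℝ x y - finitePart φ x ≤ conj φ y := by
  have := hφ.le_conjugate hx y
  rw [← hφ.coe_conj] at this
  exact_mod_cast this

lemma continuous_conj (hφ : IsPotential R φ) : Continuous (conj φ) := by
  have h : ∀ y y', conj φ y ≤ conj φ y' + dist y y' := fun y y' => by
    refine hφ.conj_le fun x hx => ?_
    have h1 := hφ.le_conj hx y'
    have h2 : inner ℝ x y = inner ℝ x y' + inner ℝ x (y - y') := by
      rw [inner_sub_right]
      ring
    have h3 := real_inner_le_norm x (y - y')
    have h4 : ‖x‖ ≤ 1 := mem_closedBall_zero_iff.1 hx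
    rw [dist_eq_norm]
    nlinarith [norm_nonneg (y - y')]
  exact (LipschitzWith.of_le_add h).continuous

lemma abs_conj_sub_le (hφ : IsPotential R φ) (hψ : IsPotential R ψ) {e : ℝ}
    (h : ∀ x ∈ domain d, |finitePart φ x - finitePart ψ x| ≤ e) (y : Space d) :
    |conj φ y - conj ψ y| ≤ e := by
  have h1 : conj φ y ≤ conj ψ y + e := hφ.conj_le fun x hx => by
    have := hψ.le_conj hx y
    linarith [(abs_le.1 (h x hx)).1]
  have h2 : conj ψ y ≤ conj φ y + e := hψ.conj_le fun x hx => by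
    have := hφ.le_conj hx y
    linarith [(abs_le.1 (h x hx)).2]
  exact abs_le.2 ⟨by linarith, by linarith⟩

lemma abs_finitePart_sub_le (hφ : IsPotential R φ) (hψ : IsPotential R ψ) {x : Space d}
    (hx : x ∈ domain d) : |finitePart φ x - finitePart ψ x| ≤ 2 * R := by
  have := abs_sub (finitePart φ x) (finitePart ψ x)
  linarith [hφ.abs_finitePart_le hx, hψ.abs_finitePart_le hx]

/-- Upper bound for the gap in the Fenchel–Young inequality. -/
lemma gap_le (hφ : IsPotential R φ) {x : Space d} (hx : x ∈ Metric.ball (0 : Space d) 1)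
    (y : Space d) :
    conj φ y + finitePart φ x - inner ℝ x y ≤ ‖grad φ x - y‖ ^ 2 := by
  have : conj φ y ≤ ‖grad φ x - y‖ ^ 2 - finitePart φ x + inner ℝ x y := by
    refine hφ.conj_le fun x' hx' => ?_
    have h1 := hφ.inner_grad_add_le hx hx'
    have h2 : inner ℝ (grad φ x) (x' - x) =
        inner ℝ (grad φ x - y) (x' - x) + inner ℝ x' y - inner ℝ x y := by
      rw [inner_sub_left, inner_sub_right y, real_inner_comm x' y, real_inner_comm x y]
      ring
    have h3 := abs_real_inner_le_norm (grad φ x - y) (x' - x)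
    have h4 := (abs_le.1 h3).1
    -- The term ‖x' - x‖²/4 from strong convexity absorbs the linear term, uniformly in x'.
    nlinarith [sq_nonneg (‖grad φ x - y‖ - 1 / 2 * ‖x' - x‖)]
  linarith

lemma gap_nonneg (hφ : IsPotential R φ) {x : Space d} (hx : x ∈ domain d) (y : Space d) :
    0 ≤ conj φ y + finitePart φ x - inner ℝ x y := by
  linarith [hφ.le_conj hx y]

/-- Lower bound for the gap in the Fenchel–Young inequality. -/
lemma le_gap (hφ : IsPotential R φ) {x y : Space d} {s : ℝ}
    (hs : 0 ≤ s) (hs' : s ≤ 1 / 2) (hxs : ‖x‖ + s * ‖grad φ x - y‖ < 1) :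
    s / 2 * ‖grad φ x - y‖ ^ 2 ≤ conj φ y + finitePart φ x - inner ℝ x y := by
  set w := grad φ x - y with hw
  have hx : x ∈ Metric.ball (0 : Space d) 1 := by
    rw [mem_ball_zero_iff]
    nlinarith [norm_nonneg w]
  -- The conjugate is tested at the gradient-descent point x - s w, which must stay in the open
  -- ball, where the Hessian bound holds.
  have hx' : x + (-s) • w ∈ Metric.ball (0 : Space d) 1 := by
    rw [mem_ball_zero_iff]
    refine (norm_add_le _ _).trans_lt ?_
    rwa [norm_smul, norm_neg, Real.norm_of_nonneg hs]
  have h1 := hφ.finitePart_add_le hx hx'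
  have h2 := hφ.le_conj (ball_subset_domain d hx') y
  have h3 : inner ℝ (grad φ x) ((-s) • w) = inner ℝ ((-s) • w) y - s * ‖w‖ ^ 2 := by
    rw [real_inner_smul_right, real_inner_smul_left, ← real_inner_self_eq_norm_sq,
      real_inner_comm y w]
    have : inner ℝ w w = inner ℝ (grad φ x) w - inner ℝ y w := by
      rw [← inner_sub_left]
    rw [this]
    ring
  have h4 : ‖(-s) • w‖ ^ 2 = s ^ 2 * ‖w‖ ^ 2 := by
    rw [norm_smul, norm_neg, Real.norm_of_nonneg hs]
    ring
  rw [inner_add_left] at h2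
  rw [h3, h4] at h1
  -- The gain is (s - s²) ‖w‖², at least s/2 * ‖w‖² because s ≤ 1/2.
  have h5 : s ^ 2 * ‖w‖ ^ 2 ≤ s / 2 * ‖w‖ ^ 2 := by
    gcongr
    nlinarith
  linarith

lemma conj_grad (hφ : IsPotential R φ) {x : Space d} (hx : x ∈ Metric.ball (0 : Space d) 1) :
    conj φ (grad φ x) = inner ℝ x (grad φ x) - finitePart φ x := by
  have h1 := hφ.gap_le hx (grad φ x)
  have h2 := hφ.gap_nonneg (ball_subset_domain d hx) (grad φ x)
  rw [sub_self, norm_zero] at h1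
  linarith

end IsPotential

end Potential

/-! ### Growth and variance in terms of the gradient error -/

section Error

open Filter Topology

variable {d : ℕ} {R ρ c : ℝ} {φ₀ φ : Space d → EReal} {μ : Measure (Space d)}

lemma measurable_grad (φ : Space d → EReal) : Measurable (grad φ) :=
  (InnerProductSpace.toDual ℝ (Space d)).symm.continuous.measurable.comp (measurable_fderiv ℝ _)

lemma ae_mem_closedBall (hμ : μ.support ⊆ Metric.closedBall 0 ρ) :
    ∀ᵐ x ∂μ, x ∈ Metric.closedBall (0 : Space d) ρ :=
  Filter.mem_of_superset Measure.support_mem_ae hμ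

/-- The squared `L²(μ)` distance between the gradients, as a real number. -/
def gradDistSq (μ : Measure (Space d)) (φ φ₀ : Space d → EReal) : ℝ :=
  ∫ x, ‖grad φ x - grad φ₀ x‖ ^ 2 ∂μ

lemma gradDistSq_nonneg : 0 ≤ gradDistSq μ φ φ₀ := integral_nonneg fun _ => sq_nonneg _

/-- A bound for the gradient of a potential on the ball of radius `ρ`. -/
def gradBound (R ρ : ℝ) : ℝ := 2 * R / (1 - ρ)

lemma norm_grad_sub_grad_le (hφ : IsPotential R φ) (hφ₀ : IsPotential R φ₀) (hρ : ρ < 1)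
    {x : Space d} (hx : x ∈ Metric.closedBall (0 : Space d) ρ) :
    ‖grad φ x - grad φ₀ x‖ ≤ 2 * gradBound R ρ := by
  have h1 : ‖grad φ x‖ ≤ gradBound R ρ := hφ.norm_grad_le hρ hx
  have h2 : ‖grad φ₀ x‖ ≤ gradBound R ρ := hφ₀.norm_grad_le hρ hx
  linarith [norm_sub_le (grad φ x) (grad φ₀ x)]

lemma sq_norm_grad_sub_grad_le (hφ : IsPotential R φ) (hφ₀ : IsPotential R φ₀) (hρ : ρ < 1)
    {x : Space d} (hx : x ∈ Metric.closedBall (0 : Space d) ρ) :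
    ‖grad φ x - grad φ₀ x‖ ^ 2 ≤ (2 * gradBound R ρ) ^ 2 :=
  pow_le_pow_left₀ (norm_nonneg _) (norm_grad_sub_grad_le hφ hφ₀ hρ hx) 2

lemma integrable_sq_norm_grad_sub_grad [IsProbabilityMeasure μ] (hφ : IsPotential R φ)
    (hφ₀ : IsPotential R φ₀) (hρ : ρ < 1) (hμ : μ.support ⊆ Metric.closedBall 0 ρ) :
    Integrable (fun x => ‖grad φ x - grad φ₀ x‖ ^ 2) μ := by
  refine Integrable.of_bound (C := (2 * gradBound R ρ) ^ 2)
    (((measurable_grad φ).sub (measurable_grad φ₀)).norm.pow_const 2).aestronglyMeasurable ?_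
  filter_upwards [ae_mem_closedBall hμ] with x hx
  rw [Real.norm_of_nonneg (sq_nonneg _)]
  exact sq_norm_grad_sub_grad_le hφ hφ₀ hρ hx

lemma mapError_eq [IsProbabilityMeasure μ] (hφ : IsPotential R φ)
    (hφ₀ : IsPotential R φ₀) (hρ : ρ < 1) (hμ : μ.support ⊆ Metric.closedBall 0 ρ) :
    mapError μ φ φ₀ = ENNReal.ofReal (gradDistSq μ φ φ₀) := by
  rw [gradDistSq, ofReal_integral_eq_lintegral_ofReal
    (integrable_sq_norm_grad_sub_grad hφ hφ₀ hρ hμ) (.of_forall fun _ => sq_nonneg _)]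
  refine lintegral_congr fun x => ?_
  rw [ENNReal.ofReal_pow (norm_nonneg _), ofReal_norm]

lemma gradDistSq_le [IsProbabilityMeasure μ] (hφ : IsPotential R φ)
    (hφ₀ : IsPotential R φ₀) (hρ : ρ < 1) (hμ : μ.support ⊆ Metric.closedBall 0 ρ) :
    gradDistSq μ φ φ₀ ≤ (2 * gradBound R ρ) ^ 2 := by
  have := integral_mono_ae (integrable_sq_norm_grad_sub_grad hφ hφ₀ hρ hμ)
    (integrable_const ((2 * gradBound R ρ) ^ 2))
    ((ae_mem_closedBall hμ).mono fun x hx => sq_norm_grad_sub_grad_le hφ hφ₀ hρ hx)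
  simpa [gradDistSq] using this

/-- The difference `φ₀ - φ`, cut off outside the ball of radius `ρ`. -/
def primalDiff (ρ : ℝ) (φ₀ φ : Space d → EReal) : Space d → ℝ :=
  (Metric.closedBall (0 : Space d) ρ).indicator fun x => finitePart φ₀ x - finitePart φ x

/-- The difference of the conjugates. -/
def dualDiff (φ₀ φ : Space d → EReal) (y : Space d) : ℝ := conj φ₀ y - conj φ y

lemma primalDiff_of_mem {x : Space d} (hx : x ∈ Metric.closedBall (0 : Space d) ρ) :
    primalDiff ρ φ₀ φ x = finitePart φ₀ x - finitePart φ x := Set.indicator_of_mem hx _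

lemma measurable_primalDiff (hφ : IsPotential R φ) (hφ₀ : IsPotential R φ₀) (hρ : ρ < 1) :
    Measurable (primalDiff ρ φ₀ φ) := by
  classical
  have hs := Metric.closedBall_subset_ball (x := (0 : Space d)) hρ
  have h : ContinuousOn (fun x => finitePart φ₀ x - finitePart φ x)
      (Metric.closedBall (0 : Space d) ρ) :=
    (hφ₀.contDiffOn.continuousOn.mono hs).sub (hφ.contDiffOn.continuousOn.mono hs)
  rw [primalDiff, ← Set.piecewise_eq_indicator]
  exact h.measurable_piecewise continuousOn_const Metric.isClosed_closedBall.measurableSet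

lemma closedBall_subset_domain (hρ : ρ < 1) : Metric.closedBall (0 : Space d) ρ ⊆ domain d :=
  Metric.closedBall_subset_closedBall hρ.le

lemma abs_primalDiff_le (hφ : IsPotential R φ) (hφ₀ : IsPotential R φ₀) (hρ : ρ < 1)
    (x : Space d) : |primalDiff ρ φ₀ φ x| ≤ 2 * R := by
  by_cases hx : x ∈ Metric.closedBall (0 : Space d) ρ
  · rw [primalDiff_of_mem hx]
    exact hφ₀.abs_finitePart_sub_le hφ (closedBall_subset_domain hρ hx)
  · rw [primalDiff, Set.indicator_of_notMem hx, abs_zero]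
    linarith [hφ.nonneg]

lemma measurable_dualDiff (hφ : IsPotential R φ) (hφ₀ : IsPotential R φ₀) :
    Measurable (dualDiff φ₀ φ) :=
  (hφ₀.continuous_conj.sub hφ.continuous_conj).measurable

lemma abs_dualDiff_le (hφ : IsPotential R φ) (hφ₀ : IsPotential R φ₀) (y : Space d) :
    |dualDiff φ₀ φ y| ≤ 2 * R :=
  hφ₀.abs_conj_sub_le hφ (fun _ hx => hφ₀.abs_finitePart_sub_le hφ hx) y

/-- The Fenchel–Young gap of `φ` along the graph of `∇φ₀`, in terms of the two differences. -/
lemma gap_eq (hφ₀ : IsPotential R φ₀) (hρ : ρ < 1) {x : Space d}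
    (hx : x ∈ Metric.closedBall (0 : Space d) ρ) :
    conj φ (grad φ₀ x) + finitePart φ x - inner ℝ x (grad φ₀ x) =
      -(primalDiff ρ φ₀ φ x + dualDiff φ₀ φ (grad φ₀ x)) := by
  rw [primalDiff_of_mem hx, dualDiff, hφ₀.conj_grad (Metric.closedBall_subset_ball hρ hx)]
  ring

/-- A smooth extension of `φ₀ - φ` from the ball of radius `ρ` to the whole space. -/
lemma exists_contDiff_extension (hφ : IsPotential R φ) (hφ₀ : IsPotential R φ₀) (hρ : ρ < 1) :
    ∃ h : Space d → ℝ, ContDiff ℝ 1 h ∧ (∀ x, |h x| ≤ 2 * R) ∧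
      ∀ x ∈ Metric.closedBall (0 : Space d) ρ, h x = finitePart φ₀ x - finitePart φ x ∧
        gradient h x = grad φ₀ x - grad φ x := by
  have hρ0 : 0 ≤ max ρ 0 := le_max_right _ _
  have hρ1 : max ρ 0 < 1 := max_lt hρ one_pos
  -- The radii lie strictly between `max ρ 0` and 1; the maximum handles a negative ρ.
  let χ : ContDiffBump (0 : Space d) :=
    ⟨(1 + max ρ 0) / 2, (3 + max ρ 0) / 4, by linarith, by linarith⟩
  have hχ : tsupport χ ⊆ Metric.ball (0 : Space d) 1 := by
    rw [χ.tsupport_eq]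
    exact Metric.closedBall_subset_ball (show (3 + max ρ 0) / 4 < 1 by linarith)
  refine ⟨fun x => χ x * (finitePart φ₀ x - finitePart φ x), ?_, ?_, ?_⟩
  · rw [contDiff_iff_contDiffAt]
    intro x
    by_cases hx : x ∈ Metric.ball (0 : Space d) 1
    · exact χ.contDiffAt.mul
        (((hφ₀.contDiffAt hx).sub (hφ.contDiffAt hx)).of_le (by norm_num))
    · have h0 := notMem_tsupport_iff_eventuallyEq.1 fun h => hx (hχ h)
      refine (contDiffAt_const (c := (0 : ℝ))).congr_of_eventuallyEq (h0.mono fun y hy => ?_)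
      simp [hy]
  · intro x
    by_cases hx : x ∈ domain d
    · rw [abs_mul, abs_of_nonneg χ.nonneg]
      exact (mul_le_of_le_one_left (abs_nonneg _) χ.le_one).trans
        (hφ₀.abs_finitePart_sub_le hφ hx)
    · have : χ x = 0 := by
        by_contra h
        exact hx (ball_subset_domain d (hχ (subset_tsupport _ h)))
      simp only [this, zero_mul, abs_zero]
      linarith [hφ.nonneg]
  · intro x hx
    have hx1 := Metric.closedBall_subset_ball hρ hx
    have hxr : x ∈ Metric.ball (0 : Space d) χ.rIn := by
      refine Metric.closedBall_subset_ball (show ρ < (1 + max ρ 0) / 2 from ?_) hx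
      linarith [le_max_left ρ 0]
    have hev : (fun x => χ x * (finitePart φ₀ x - finitePart φ x)) =ᶠ[𝓝 x]
        fun x => finitePart φ₀ x - finitePart φ x := by
      filter_upwards [χ.eventuallyEq_one_of_mem_ball hxr] with y hy
      simp [hy]
    refine ⟨hev.eq_of_nhds, ?_⟩
    rw [gradient, hev.fderiv_eq, fderiv_fun_sub (hφ₀.differentiableAt hx1)
      (hφ.differentiableAt hx1), map_sub]
    rfl

/-- The Poincaré inequality applied to a global C¹ extension, which agrees with the difference,
gradient included, on the ball carrying μ. The constant is replaced by `max c 0` since c may be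
negative. -/
lemma variance_primalDiff_le [IsProbabilityMeasure μ] (hφ : IsPotential R φ)
    (hφ₀ : IsPotential R φ₀) (hρ : ρ < 1) (hμ : μ.support ⊆ Metric.closedBall 0 ρ)
    (hP : Poincare c μ) :
    variance (primalDiff ρ φ₀ φ) μ ≤ max c 0 * gradDistSq μ φ φ₀ := by
  obtain ⟨h, hc, hb, hh⟩ := exists_contDiff_extension hφ hφ₀ hρ
  have hmem : MemLp h 2 μ := memLp_of_abs_le hc.continuous.measurable hb
  have hae : primalDiff ρ φ₀ φ =ᵐ[μ] h := by
    filter_upwards [ae_mem_closedBall hμ] with x hx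
    rw [primalDiff_of_mem hx, (hh x hx).1]
  have h1 := hP h hc hmem
  have h2 : ∫⁻ x, ‖gradient h x‖ₑ ^ 2 ∂μ = ENNReal.ofReal (gradDistSq μ φ φ₀) := by
    rw [← mapError_eq hφ hφ₀ hρ hμ, mapError]
    refine lintegral_congr_ae ?_
    filter_upwards [ae_mem_closedBall hμ] with x hx
    rw [(hh x hx).2, ← enorm_neg, neg_sub]
  have h3 : ENNReal.ofReal c = ENNReal.ofReal (max c 0) := by
    rw [ENNReal.ofReal_max, ENNReal.ofReal_zero, max_eq_left zero_le]
  rw [h2, h3, ← ENNReal.ofReal_mul (le_max_right _ _)] at h1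
  rw [variance_congr hae]
  rw [← ENNReal.ofReal_le_ofReal_iff (mul_nonneg (le_max_right _ _) gradDistSq_nonneg),
    hmem.ofReal_variance_eq]
  exact h1

/-- Composed with ∇φ₀, the dual difference is the negative of the primal one up to the gap. The gap
is at most ‖∇φ - ∇φ₀‖², so its square is at most (2 `gradBound R ρ`)² ‖∇φ - ∇φ₀‖². -/
lemma variance_dualDiff_le [IsProbabilityMeasure μ] (hφ : IsPotential R φ)
    (hφ₀ : IsPotential R φ₀) (hρ : ρ < 1) (hμ : μ.support ⊆ Metric.closedBall 0 ρ)
    (hP : Poincare c μ) :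
    variance (dualDiff φ₀ φ) (μ.map (grad φ₀)) ≤
      2 * ((2 * gradBound R ρ) ^ 2 + max c 0) * gradDistSq μ φ φ₀ := by
  rw [variance_map (measurable_dualDiff hφ hφ₀).aemeasurable (measurable_grad φ₀).aemeasurable]
  have h1 := variance_le_two_mul_add (P := μ) (g := dualDiff φ₀ φ ∘ grad φ₀)
    (h := fun x => -primalDiff ρ φ₀ φ x)
    ((measurable_dualDiff hφ hφ₀).comp (measurable_grad φ₀))
    (fun x => abs_dualDiff_le hφ hφ₀ _) (measurable_primalDiff hφ hφ₀ hρ).neg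
    (fun x => (abs_neg _).trans_le (abs_primalDiff_le hφ hφ₀ hρ x))
  have h2 : variance (fun x => -primalDiff ρ φ₀ φ x) μ = variance (primalDiff ρ φ₀ φ) μ :=
    variance_neg
  have h3 : ∫ x, ((dualDiff φ₀ φ ∘ grad φ₀) x - -primalDiff ρ φ₀ φ x) ^ 2 ∂μ ≤
      (2 * gradBound R ρ) ^ 2 * gradDistSq μ φ φ₀ := by
    rw [gradDistSq, ← integral_const_mul]
    refine integral_mono_of_nonneg (.of_forall fun x => sq_nonneg _)
      ((integrable_sq_norm_grad_sub_grad hφ hφ₀ hρ hμ).const_mul _) ?_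
    filter_upwards [ae_mem_closedBall hμ] with x hx
    have h4 := hφ.gap_le (Metric.closedBall_subset_ball hρ hx) (grad φ₀ x)
    have h5 := hφ.gap_nonneg (closedBall_subset_domain hρ hx) (grad φ₀ x)
    have h6 := sq_norm_grad_sub_grad_le hφ hφ₀ hρ hx
    rw [gap_eq hφ₀ hρ hx] at h4 h5
    simp only [Function.comp]
    nlinarith [sq_nonneg ‖grad φ x - grad φ₀ x‖]
  have h7 := variance_primalDiff_le hφ hφ₀ hρ hμ hP
  rw [h2] at h1
  linarith

/-- The constant in the lower bound of the semidual functional by the squared error. -/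
def growth (R ρ : ℝ) : ℝ := min (1 / 2) ((1 - ρ) / (2 * (2 * gradBound R ρ + 1))) / 2

lemma gradBound_nonneg (hR : 0 ≤ R) (hρ : ρ < 1) : 0 ≤ gradBound R ρ :=
  div_nonneg (by linarith) (by linarith)

lemma growth_pos (hR : 0 ≤ R) (hρ : ρ < 1) : 0 < growth R ρ := by
  have := gradBound_nonneg hR hρ
  have : 0 < 1 - ρ := by linarith
  exact half_pos (lt_min (by norm_num) (by positivity))

/-- `growth` is half the step length s used in `le_gap`. As ‖∇φ - ∇φ₀‖ ≤ 2 `gradBound R ρ`, the step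
moves x by less than 1 - ρ and stays in the open ball. -/
lemma growth_mul_le_gap (hφ : IsPotential R φ) (hφ₀ : IsPotential R φ₀) (hρ : ρ < 1)
    {x : Space d} (hx : x ∈ Metric.closedBall (0 : Space d) ρ) :
    growth R ρ * ‖grad φ x - grad φ₀ x‖ ^ 2 ≤
      -(primalDiff ρ φ₀ φ x + dualDiff φ₀ φ (grad φ₀ x)) := by
  have hG := gradBound_nonneg hφ.nonneg hρ
  have hρ' : 0 < 1 - ρ := by linarith
  have hs : 0 ≤ min (1 / 2) ((1 - ρ) / (2 * (2 * gradBound R ρ + 1))) :=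
    le_min (by norm_num) (by positivity)
  rw [← gap_eq hφ₀ hρ hx]
  refine hφ.le_gap hs (min_le_left _ _) ?_
  have h1 := norm_grad_sub_grad_le hφ hφ₀ hρ hx
  have h2 := mul_le_mul (min_le_right (1 / 2) ((1 - ρ) / (2 * (2 * gradBound R ρ + 1)))) h1
    (norm_nonneg _) (by positivity)
  have h3 : (1 - ρ) / (2 * (2 * gradBound R ρ + 1)) * (2 * gradBound R ρ) < 1 - ρ := by
    rw [div_mul_eq_mul_div, div_lt_iff₀ (by positivity)]
    nlinarith
  have h4 := mem_closedBall_zero_iff.1 hx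
  linarith

lemma growth_mul_gradDistSq_le [IsProbabilityMeasure μ] (hφ : IsPotential R φ)
    (hφ₀ : IsPotential R φ₀) (hρ : ρ < 1) (hμ : μ.support ⊆ Metric.closedBall 0 ρ) :
    growth R ρ * gradDistSq μ φ φ₀ ≤
      -(∫ x, primalDiff ρ φ₀ φ x ∂μ + ∫ y, dualDiff φ₀ φ y ∂(μ.map (grad φ₀))) := by
  have hg := measurable_dualDiff hφ hφ₀
  have i1 : Integrable (primalDiff ρ φ₀ φ) μ :=
    integrable_of_abs_le (measurable_primalDiff hφ hφ₀ hρ) (abs_primalDiff_le hφ hφ₀ hρ)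
  have i2 : Integrable (fun x => dualDiff φ₀ φ (grad φ₀ x)) μ :=
    integrable_of_abs_le (hg.comp (measurable_grad φ₀)) (fun x => abs_dualDiff_le hφ hφ₀ _)
  rw [integral_map (measurable_grad φ₀).aemeasurable hg.aestronglyMeasurable,
    ← integral_add i1 i2, ← integral_neg, gradDistSq, ← integral_const_mul]
  exact integral_mono_ae ((integrable_sq_norm_grad_sub_grad hφ hφ₀ hρ hμ).const_mul _)
    (i1.add i2).neg ((ae_mem_closedBall hμ).mono fun x hx => growth_mul_le_gap hφ hφ₀ hρ hx)

lemma coe_sum_ereal {ι : Type*} (s : Finset ι) (f : ι → ℝ) :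
    ((∑ i ∈ s, f i : ℝ) : EReal) = ∑ i ∈ s, (f i : EReal) := by
  classical
  induction s using Finset.induction_on with
  | empty => simp
  | insert a s ha ih => rw [Finset.sum_insert ha, Finset.sum_insert ha, EReal.coe_add, ih]

lemma empiricalSemidual_eq (hφ : IsPotential R φ) {n : ℕ} {x y : Fin n → Space d}
    (hx : ∀ i, x i ∈ domain d) :
    empiricalSemidual x y φ =
      (((n : ℝ)⁻¹ * ∑ i, finitePart φ (x i) + (n : ℝ)⁻¹ * ∑ i, conj φ (y i) : ℝ) : EReal) := by
  rw [empiricalSemidual, EReal.coe_add, EReal.coe_mul, EReal.coe_mul, coe_sum_ereal,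
    coe_sum_ereal]
  simp only [hφ.coe_conj, hφ.coe_finitePart (hx _)]

/-- The basic inequality for semidual estimators. -/
theorem growth_mul_gradDistSq_le_deviation [IsProbabilityMeasure μ] {Φ : Set (Space d → EReal)}
    (hΦ : ∀ φ ∈ Φ, IsPotential R φ) (hφ₀ : φ₀ ∈ Φ) (hρ : ρ < 1)
    (hμ : μ.support ⊆ Metric.closedBall 0 ρ) {n : ℕ} {x y : Fin n → Space d}
    (hx : ∀ i, x i ∈ Metric.closedBall (0 : Space d) ρ) (hφ : IsSemidualEstimator Φ x y φ) :
    growth R ρ * gradDistSq μ φ φ₀ ≤ deviation μ (primalDiff ρ φ₀ φ) x +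
      deviation (μ.map (grad φ₀)) (dualDiff φ₀ φ) y := by
  have h1 := growth_mul_gradDistSq_le (hΦ φ hφ.1) (hΦ φ₀ hφ₀) hρ hμ
  have hxd : ∀ i, x i ∈ domain d := fun i => closedBall_subset_domain hρ (hx i)
  have h2 := hφ.2 φ₀ hφ₀
  rw [empiricalSemidual_eq (hΦ φ hφ.1) hxd, empiricalSemidual_eq (hΦ φ₀ hφ₀) hxd,
    EReal.coe_le_coe_iff] at h2
  simp only [deviation, primalDiff_of_mem (hx _), dualDiff, Finset.sum_sub_distrib] at h1 ⊢
  linarith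

end Error

/-! ### Nets of the class and their entropy -/

section Nets

variable {d : ℕ} {R ρ c : ℝ} {Φ : Set (Space d → EReal)}

lemma exists_isCover_card_le {ε : ℝ} (h : coveringNumber ε Φ ≠ ⊤) :
    ∃ F : Finset (Space d → ℝ), IsCover ε Φ F ∧ F.card ≤ (coveringNumber ε Φ).toNat := by
  have h1 : coveringNumber ε Φ < ((coveringNumber ε Φ).toNat + 1 : ℕ) := by
    conv_lhs => rw [← ENat.natCast_toNat h]
    exact_mod_cast Nat.lt_succ_self _
  conv_lhs at h1 => rw [coveringNumber]
  obtain ⟨F, hF⟩ := iInf_lt_iff.1 h1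
  obtain ⟨hc, hF⟩ := iInf_lt_iff.1 hF
  exact ⟨F, hc, Nat.lt_succ_iff.1 (by exact_mod_cast hF)⟩

/-- An external `ε`-cover yields an internal `2 ε`-net of no larger cardinality. -/
lemma IsCover.exists_net {ε : ℝ} {F : Finset (Space d → ℝ)} (hF : IsCover ε Φ F) :
    ∃ N : Finset Φ, N.card ≤ F.card ∧ ∀ s : Φ, ∃ u ∈ N, ∀ x ∈ domain d,
      |finitePart s.1 x - finitePart u.1 x| ≤ 2 * ε := by
  classical
  rcases isEmpty_or_nonempty Φ with hΦ | ⟨⟨s₀⟩⟩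
  · exact ⟨∅, by simp, fun s => hΦ.elim s⟩
  let near : (Space d → ℝ) → Φ → Prop := fun g s => ∀ x ∈ domain d, |finitePart s.1 x - g x| ≤ ε
  let pick : (Space d → ℝ) → Φ := fun g => if h : ∃ s, near g s then h.choose else s₀
  refine ⟨F.image pick, Finset.card_image_le, fun s => ?_⟩
  obtain ⟨g, hg, hs⟩ := hF s.1 s.2
  have hex : ∃ s, near g s := ⟨s, hs⟩
  have hpick : near g (pick g) := by
    simp only [pick, dif_pos hex]
    exact hex.choose_spec
  refine ⟨pick g, Finset.mem_image_of_mem _ hg, fun x hx => ?_⟩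
  have h1 := abs_le.1 (hs x hx)
  have h2 := abs_le.1 (hpick x hx)
  rw [abs_le]
  constructor <;> linarith

lemma EntropyBound.exists_net {γ K ε₀ ε : ℝ} (h : EntropyBound γ K ε₀ Φ) (hε : 0 < ε)
    (hε' : ε ≤ ε₀) (hne : Φ.Nonempty) :
    ∃ N : Finset Φ, (N.card : ℝ) ≤ Real.exp (K * ε ^ (-γ) * Real.log (1 + ε⁻¹)) ∧
      ∀ s : Φ, ∃ u ∈ N, ∀ x ∈ domain d, |finitePart s.1 x - finitePart u.1 x| ≤ 2 * ε := by
  obtain ⟨h1, h2⟩ := h ε hε hε'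
  obtain ⟨F, hF, hcard⟩ := exists_isCover_card_le h1
  obtain ⟨N, hN, hnet⟩ := hF.exists_net
  refine ⟨N, ?_, hnet⟩
  have hpos : 0 < N.card := by
    obtain ⟨φ, hφ⟩ := hne
    obtain ⟨u, hu, -⟩ := hnet ⟨φ, hφ⟩
    exact Finset.card_pos.2 ⟨u, hu⟩
  have h3 : (N.card : ℝ) ≤ (coveringNumber ε Φ).toNat := by exact_mod_cast hN.trans hcard
  have h4 : (0 : ℝ) < N.card := by exact_mod_cast hpos
  refine h3.trans ?_
  rw [← Real.log_le_iff_le_exp (h4.trans_le h3)]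
  exact h2

/-- The rate of convergence of the gradient, up to constants. -/
def rate (γ : ℝ) (n : ℕ) : ℝ := (Real.log n / n) ^ (1 / (2 + γ))

section Rate

variable {γ : ℝ} {n : ℕ}

lemma half_le_log (hn : 2 ≤ n) : 1 / 2 ≤ Real.log n := by
  have h1 : Real.log 2 ≤ Real.log n := Real.log_le_log (by norm_num) (by exact_mod_cast hn)
  linarith [Real.log_two_gt_d9]

lemma log_div_pos (hn : 2 ≤ n) : 0 < Real.log n / n := by
  have := half_le_log hn
  have : (0 : ℝ) < n := by positivity
  positivity

lemma log_div_le_one (n : ℕ) : Real.log n / n ≤ 1 :=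
  div_le_one_of_le₀ (Real.log_le_self n.cast_nonneg) n.cast_nonneg

lemma rate_pos (hn : 2 ≤ n) : 0 < rate γ n := Real.rpow_pos_of_pos (log_div_pos hn) _

lemma rate_le_one (hγ : 0 ≤ γ) (hn : 2 ≤ n) : rate γ n ≤ 1 :=
  Real.rpow_le_one (log_div_pos hn).le (log_div_le_one n) (by positivity)

lemma rate_sq (hn : 2 ≤ n) : rate γ n ^ 2 = (Real.log n / n) ^ (2 / (2 + γ)) := by
  rw [rate, ← Real.rpow_natCast, ← Real.rpow_mul (log_div_pos hn).le]
  congr 1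
  push_cast
  ring

lemma log_div_le_rate_sq (hγ : 0 ≤ γ) (hn : 2 ≤ n) : Real.log n / n ≤ rate γ n ^ 2 := by
  rw [rate_sq hn]
  conv_lhs => rw [← Real.rpow_one (Real.log n / n)]
  refine Real.rpow_le_rpow_of_exponent_ge (log_div_pos hn) (log_div_le_one n) ?_
  rw [div_le_one (by linarith)]
  linarith

lemma inv_le_two_mul_rate_sq (hγ : 0 ≤ γ) (hn : 2 ≤ n) : (n : ℝ)⁻¹ ≤ 2 * rate γ n ^ 2 := by
  have h1 := log_div_le_rate_sq hγ hn
  have h2 := half_le_log hn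
  have h3 : (n : ℝ)⁻¹ ≤ 2 * (Real.log n / n) := by
    rw [inv_eq_one_div, ← mul_div_assoc]
    gcongr
    linarith
  linarith

lemma inv_rate_le (hγ : 0 ≤ γ) (hn : 2 ≤ n) : (rate γ n)⁻¹ ≤ 2 * n := by
  have h1 := inv_le_two_mul_rate_sq hγ hn
  have h2 := rate_pos (γ := γ) hn
  have h3 := rate_le_one hγ hn
  have hn' : (0 : ℝ) < n := by positivity
  rw [inv_le_iff_one_le_mul₀ h2]
  rw [inv_le_iff_one_le_mul₀ hn'] at h1
  nlinarith [mul_nonneg (mul_nonneg hn'.le h2.le) (sub_nonneg.2 h3)]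

/-- The defining balance of the rate: r^(-γ) log n = n r². -/
lemma rate_rpow_neg (hγ : 0 ≤ γ) (hn : 2 ≤ n) :
    rate γ n ^ (-γ) = n * rate γ n ^ 2 / Real.log n := by
  have h0 := rate_pos (γ := γ) hn
  have h1 : rate γ n ^ (2 + γ) = Real.log n / n := by
    rw [rate, ← Real.rpow_mul (log_div_pos hn).le, one_div, inv_mul_cancel₀ (by linarith),
      Real.rpow_one]
  have h2 : rate γ n ^ (-γ) = rate γ n ^ 2 / rate γ n ^ (2 + γ) := by
    rw [← Real.rpow_natCast, ← Real.rpow_sub h0]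
    congr 1
    push_cast
    ring
  have hl := half_le_log hn
  have hn' : (0 : ℝ) < n := by positivity
  rw [h2, h1]
  field_simp

/-- The entropy at the scales `a (rate γ n) 2^{-k} / 2` grows at most geometrically. -/
lemma entropy_le {a : ℝ} (K : ℝ) (hγ : 0 ≤ γ) (hγ₁ : γ < 1) (ha : 0 < a) (ha₁ : a ≤ 1)
    (hn : 2 ≤ n) {k : ℕ} (hk : (2 : ℝ) ^ k ≤ 2 * n) :
    K * (a * rate γ n * (1 / 2) ^ k / 2) ^ (-γ) *
        Real.log (1 + (a * rate γ n * (1 / 2) ^ k / 2)⁻¹) ≤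
      (max K 0 * (2 / a) * (2 * Real.log (9 / a) + 2) / a ^ 2) * n * (a * rate γ n) ^ 2 * 2 ^ k := by
  have h0 := rate_pos (γ := γ) hn
  have hl := half_le_log hn
  have hn' : (2 : ℝ) ≤ n := by exact_mod_cast hn
  have h2k : (1 : ℝ) ≤ 2 ^ k := one_le_pow₀ (by norm_num)
  have h2a : 1 ≤ 2 / a := by
    rw [le_div_iff₀ ha]
    linarith
  set ε := a * rate γ n * (1 / 2) ^ k / 2 with hε
  have hεpos : 0 < ε := by positivity
  have hεinv : ε⁻¹ = (2 / a) * (rate γ n)⁻¹ * 2 ^ k := by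
    rw [hε, one_div, inv_pow]
    field_simp
  have hpow : ε ^ (-γ) ≤ (2 / a) * (n * rate γ n ^ 2 / Real.log n) * 2 ^ k := by
    rw [Real.rpow_neg hεpos.le, ← Real.inv_rpow hεpos.le, hεinv,
      Real.mul_rpow (by positivity) (by positivity), Real.mul_rpow (by positivity) (by positivity),
      ← rate_rpow_neg hγ hn, Real.rpow_neg h0.le, ← Real.inv_rpow h0.le]
    gcongr
    -- Here γ < 1 enters: γ-th powers of 2/a and 2^k are bounded by the numbers themselves, so the
    -- entropy at most doubles per scale.
    · exact Real.rpow_le_self_of_one_le h2a hγ₁.le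
    · exact Real.rpow_le_self_of_one_le h2k hγ₁.le
  have hlog : Real.log (1 + ε⁻¹) ≤ (2 * Real.log (9 / a) + 2) * Real.log n := by
    have h1 : 1 + ε⁻¹ ≤ 9 / a * n ^ 2 := by
      -- Both 1/r and 2^k are at most 2n, so the logarithm is O(log n) at every scale used.
      have h2 : ε⁻¹ ≤ 2 / a * (2 * n) * (2 * n) := by
        rw [hεinv]
        gcongr
        exact inv_rate_le hγ hn
      have h3 : 1 ≤ 1 / a * n ^ 2 := by
        have : 1 ≤ 1 / a := by rwa [le_div_iff₀ ha, one_mul]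
        nlinarith
      calc 1 + ε⁻¹ ≤ 1 / a * n ^ 2 + 2 / a * (2 * n) * (2 * n) := by linarith
        _ = 9 / a * n ^ 2 := by ring
    refine (Real.log_le_log (by positivity) h1).trans ?_
    rw [Real.log_mul (by positivity) (by positivity), Real.log_pow]
    have h9 : 0 ≤ Real.log (9 / a) := Real.log_nonneg (by
      rw [le_div_iff₀ ha]
      linarith)
    push_cast
    nlinarith
  have hlog0 : 0 ≤ Real.log (1 + ε⁻¹) := Real.log_nonneg (by
    have := inv_pos.2 hεpos
    linarith)
  calc K * ε ^ (-γ) * Real.log (1 + ε⁻¹) ≤ max K 0 * ε ^ (-γ) * Real.log (1 + ε⁻¹) := by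
        gcongr
        exact le_max_left _ _
    _ ≤ max K 0 * ((2 / a) * (n * rate γ n ^ 2 / Real.log n) * 2 ^ k) *
          ((2 * Real.log (9 / a) + 2) * Real.log n) := by
        gcongr
    _ = _ := by
        field_simp

end Rate

/-- The nets needed for chaining. -/
lemma EntropyBound.exists_nets {γ K ε₀ a : ℝ} (h : EntropyBound γ K ε₀ Φ) (hne : Φ.Nonempty)
    (hγ : 0 ≤ γ) (hγ₁ : γ < 1) (ha : 0 < a) (ha₁ : a ≤ 1) (haε : a ≤ ε₀) {n : ℕ} (hn : 2 ≤ n) :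
    ∃ N : ℕ → Finset Φ, ∀ k, (2 : ℝ) ^ k ≤ 2 * n →
      ((N k).card : ℝ) ≤ Real.exp ((max K 0 * (2 / a) * (2 * Real.log (9 / a) + 2) / a ^ 2) * n *
        (a * rate γ n) ^ 2 * 2 ^ k) ∧
      ∀ s : Φ, ∃ u ∈ N k, ∀ x ∈ domain d,
        |finitePart s.1 x - finitePart u.1 x| ≤ a * rate γ n * (1 / 2) ^ k := by
  have h0 := rate_pos (γ := γ) hn
  have key : ∀ k, ∃ N : Finset Φ, (2 : ℝ) ^ k ≤ 2 * n →
      (N.card : ℝ) ≤ Real.exp ((max K 0 * (2 / a) * (2 * Real.log (9 / a) + 2) / a ^ 2) * n *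
        (a * rate γ n) ^ 2 * 2 ^ k) ∧
      ∀ s : Φ, ∃ u ∈ N, ∀ x ∈ domain d,
        |finitePart s.1 x - finitePart u.1 x| ≤ a * rate γ n * (1 / 2) ^ k := by
    intro k
    have hε : a * rate γ n * (1 / 2) ^ k / 2 ≤ ε₀ := by
      have h1 : ((1 : ℝ) / 2) ^ k ≤ 1 := pow_le_one₀ (by norm_num) (by norm_num)
      have h2 : a * rate γ n * (1 / 2) ^ k ≤ a * 1 * 1 := by
        gcongr
        exact rate_le_one hγ hn
      linarith
    obtain ⟨N, hN, hnet⟩ := h.exists_net (by positivity) hε hne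
    refine ⟨N, fun hk => ⟨hN.trans (Real.exp_le_exp.2 (entropy_le K hγ hγ₁ ha ha₁ hn hk)), ?_⟩⟩
    intro s
    obtain ⟨u, hu, hsu⟩ := hnet s
    refine ⟨u, hu, fun x hx => (hsu x hx).trans (le_of_eq ?_)⟩
    ring
  choose N hN using key
  exact ⟨N, hN⟩

end Nets

/-! ### Tail bound for the estimator -/

section Assembly

variable {W : Type*} [MeasurableSpace W]

lemma ofReal_exp_neg_natCast_le (j : ℕ) : ENNReal.ofReal (Real.exp (-(j : ℝ))) ≤ 2⁻¹ ^ j := by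
  have he : Real.exp (-1) ≤ 2⁻¹ := by
    rw [Real.exp_neg]
    exact inv_anti₀ (by norm_num) (by linarith [Real.add_one_le_exp (1 : ℝ)])
  have h1 : Real.exp (-(j : ℝ)) = Real.exp (-1) ^ j := by
    rw [← Real.exp_nat_mul]
    congr 1
    ring
  rw [h1, ENNReal.ofReal_pow (Real.exp_pos _).le]
  gcongr
  refine (ENNReal.ofReal_le_ofReal he).trans (le_of_eq ?_)
  rw [ENNReal.ofReal_inv_of_pos two_pos, ENNReal.ofReal_ofNat]

/-- Integrating an exponential tail bound; the integrand need not be measurable. -/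
lemma lintegral_le_of_exp_tail {Pr : Measure W} [IsProbabilityMeasure Pr] {F : W → ENNReal}
    {a b : ENNReal} (hb : b ≠ 0)
    (hF : ∀ j : ℕ, Pr {ω | a + b * j < F ω} ≤ ENNReal.ofReal (Real.exp (-(j : ℝ)))) :
    ∫⁻ ω, F ω ∂Pr ≤ a + b * 2 := by
  let S : ℕ → Set W := fun j => toMeasurable Pr {ω | a + b * j < F ω}
  have hS : ∀ j, MeasurableSet (S j) := fun j => measurableSet_toMeasurable _ _
  let N : W → ENNReal := fun ω => ∑' j, (S j).indicator 1 ω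
  have hmem : ∀ (j : ℕ) ω, a + b * j < F ω → (S j).indicator (1 : W → ENNReal) ω = 1 := fun j ω h => by
    have hω : ω ∈ S j := subset_toMeasurable Pr {ω | a + b * j < F ω} h
    rw [Set.indicator_of_mem hω, Pi.one_apply]
  -- N ω is at least the number of levels a + b j lying below F ω. The sets are measurable hulls, so
  -- N is measurable even when F is not.
  have hFN : ∀ ω, F ω ≤ a + b * N ω := by
    intro ω
    by_cases h : ∀ j : ℕ, a + b * j < F ω
    · have : N ω = ⊤ := by
        simp only [N, fun j => hmem j ω (h j)]
        exact ENNReal.tsum_const_eq_top_of_ne_zero one_ne_zero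
      rw [this, ENNReal.mul_top hb, add_top]
      exact le_top
    · classical
      push Not at h
      have hk := Nat.find_spec h
      refine hk.trans ?_
      gcongr
      have h1 : ∑ j ∈ Finset.range (Nat.find h), (S j).indicator (1 : W → ENNReal) ω =
          (Nat.find h : ENNReal) := by
        rw [Finset.sum_congr rfl fun j hj =>
          hmem j ω (not_le.1 (Nat.find_min h (Finset.mem_range.1 hj)))]
        simp
      rw [← h1]
      exact ENNReal.sum_le_tsum _
  have hind : ∀ j, Measurable ((S j).indicator (1 : W → ENNReal)) := fun j =>
    measurable_one.indicator (hS j)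
  calc ∫⁻ ω, F ω ∂Pr ≤ ∫⁻ ω, (a + b * N ω) ∂Pr := lintegral_mono hFN
    _ = a + b * ∑' j, Pr (S j) := by
        rw [lintegral_add_left measurable_const, lintegral_const, measure_univ, mul_one,
          lintegral_const_mul _ (Measurable.tsum hind),
          lintegral_tsum fun j => (hind j).aemeasurable]
        simp only [lintegral_indicator_one (hS _)]
    _ ≤ a + b * ∑' j : ℕ, 2⁻¹ ^ j := by
        gcongr with j
        rw [measure_toMeasurable]
        exact (hF j).trans (ofReal_exp_neg_natCast_le j)
    _ = a + b * 2 := by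
        rw [ENNReal.tsum_geometric, ENNReal.one_sub_inv_two, inv_inv]

/-- The constant in the uniform deviation bound. -/
def deviationConst (l A : ℝ) : ℝ := 2 * l + (|A| + 1) / l + (8 + 18 * |A|) + 11

/-- The constant governing the entropy of the nets. -/
def entropyConst (K a : ℝ) : ℝ := max K 0 * (2 / a) * (2 * Real.log (9 / a) + 2) / a ^ 2

lemma exists_event_forall_class_deviation_le {γ K ε₀ a B l t : ℝ} {d n : ℕ}
    {Φ : Set (Space d → EReal)} {Pr : Measure W} [IsProbabilityMeasure Pr]
    {P : Measure (Space d)} [IsProbabilityMeasure P] {Z : Fin n → W → Space d}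
    (hΦ : EntropyBound γ K ε₀ Φ) (hne : Φ.Nonempty) (hγ : 0 ≤ γ) (hγ₁ : γ < 1) (ha : 0 < a)
    (ha₁ : a ≤ 1) (haε : a ≤ ε₀) (hn : 2 ≤ n) (hZ : IsIIDSample Pr Z P)
    (f : Φ → Space d → ℝ) (hm : ∀ s, Measurable (f s)) (hB : ∀ s z, |f s z| ≤ B)
    (hf : ∀ s u : Φ, ∀ e, (∀ x ∈ domain d, |finitePart s.1 x - finitePart u.1 x| ≤ e) →
      ∀ z, |f s z - f u z| ≤ e)
    (hl : 0 < l) (hlB : l * (2 * B) ≤ 1) (ht : 0 ≤ t) :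
    ∃ D : Set W, Pr D ≤ ENNReal.ofReal (Real.exp (-t)) ∧ ∀ ω ∉ D, ∀ s,
      deviation P (f s) (fun j => Z j ω) ≤ 2 * l * variance (f s) P +
        deviationConst l (entropyConst K a) * (rate γ n ^ 2 + (t + 1) / n) := by
  obtain ⟨N, hN⟩ := hΦ.exists_nets hne hγ hγ₁ ha ha₁ haε hn
  have h0 := rate_pos (γ := γ) hn
  have hn' : (0 : ℝ) < n := by positivity
  -- This gives n ≤ 2^m ≤ 2n: the last net has resolution at most 1/n, yet its entropy bound still
  -- applies.
  set m := Nat.clog 2 n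
  have hm1 : (2 : ℝ) ^ m ≤ 2 * n := by
    have h1 : 2 ^ m.pred < n := Nat.pow_pred_clog_lt_self one_lt_two (by omega)
    have h2 : 2 ^ m = 2 * 2 ^ m.pred := by
      rw [← pow_succ']
      exact congrArg _ (Nat.succ_pred_eq_of_pos (Nat.clog_pos one_lt_two hn)).symm
    have h3 : 2 ^ m ≤ 2 * n := by omega
    exact_mod_cast h3
  have hm2 : (n : ℝ) ≤ 2 ^ m := by exact_mod_cast Nat.le_pow_clog one_lt_two n
  have hk : ∀ k ≤ m, (2 : ℝ) ^ k ≤ 2 * n := fun k hk =>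
    (pow_le_pow_right₀ (by norm_num) hk).trans hm1
  set A := entropyConst K a with hA
  obtain ⟨D, hD, hD'⟩ := exists_event_forall_deviation_le (by omega) hZ.1 hZ.2.1 hZ.2.2 f hm hB hl
    hlB (mul_pos ha h0) ht (m := m) (A := A) N
    (fun k hkm s => by
      obtain ⟨u, hu, hsu⟩ := (hN k (hk k hkm)).2 s
      exact ⟨u, hu, hf s u _ hsu⟩) (fun k hkm => (hN k (hk k hkm)).1)
  refine ⟨D, hD, fun ω hω s => (hD' ω hω s).trans ?_⟩
  have hr : (a * rate γ n) ^ 2 ≤ rate γ n ^ 2 := by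
    gcongr
    exact mul_le_of_le_one_left h0.le ha₁
  set T := (t + 1) / (n : ℝ) with hT
  have hT0 : 0 ≤ T := by positivity
  have hlast : a * rate γ n * (1 / 2) ^ m ≤ T := by
    calc a * rate γ n * (1 / 2) ^ m ≤ 1 * 1 * (1 / n) := by
          rw [one_div_pow]
          gcongr
          exact rate_le_one hγ hn
      _ ≤ T := by
          rw [one_mul, one_mul, hT]
          gcongr
          linarith
  have h1 : (A * (a * rate γ n) ^ 2 + T) / l ≤ (|A| + 1) / l * (rate γ n ^ 2 + T) := by
    rw [div_mul_eq_mul_div]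
    gcongr
    have h2 : A * (a * rate γ n) ^ 2 ≤ |A| * rate γ n ^ 2 :=
      mul_le_mul (le_abs_self A) hr (sq_nonneg _) (abs_nonneg A)
    nlinarith [abs_nonneg A, mul_nonneg (abs_nonneg A) hT0, sq_nonneg (rate γ n)]
  have h3 : 2 * l * (a * rate γ n) ^ 2 ≤ 2 * l * (rate γ n ^ 2 + T) := by
    gcongr
    linarith
  have h4 : (8 + 18 * |A|) * (a * rate γ n) ^ 2 ≤ (8 + 18 * |A|) * (rate γ n ^ 2 + T) := by
    gcongr
    linarith
  have h5 : 9 * (t + 1) / (n : ℝ) = 9 * T := by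
    rw [hT]
    ring
  rw [h5, deviationConst]
  nlinarith [sq_nonneg (rate γ n)]

/-- The tail bound for `n ≥ 2`. -/
lemma exists_const_measure_mapError_gt_le {γ R K ε₀ c ρ : ℝ} (hγ : 0 ≤ γ) (hγ₁ : γ < 1)
    (hε₀ : 0 < ε₀) (hρ : ρ < 1) (hR : 0 ≤ R) :
    ∃ C : ℝ, 0 < C ∧ ∀ (d : ℕ) (μ : Measure (Space d)) (Φ : Set (Space d → EReal))
      (φ₀ : Space d → EReal), IsProbabilityMeasure μ → μ.support ⊆ Metric.closedBall 0 ρ →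
      (∀ φ ∈ Φ, IsPotential R φ) → φ₀ ∈ Φ → EntropyBound γ K ε₀ Φ → Poincare c μ →
      ∀ (W : Type u) [MeasurableSpace W] (Pr : Measure W) (n : ℕ) (X Y : Fin n → W → Space d)
        (φhat : W → Space d → EReal), IsProbabilityMeasure Pr → 2 ≤ n → IsIIDSample Pr X μ →
        IsIIDSample Pr Y (μ.map (grad φ₀)) →
        (∀ᵐ ω ∂Pr, IsSemidualEstimator Φ (fun i => X i ω) (fun i => Y i ω) (φhat ω)) →
        ∀ t : ℝ, 0 ≤ t →
          Pr {ω | ENNReal.ofReal (C * (rate γ n ^ 2 + (t + 1) / n)) < mapError μ (φhat ω) φ₀} ≤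
            ENNReal.ofReal (Real.exp (-t)) := by
  set κ := growth R ρ
  have hκ : 0 < κ := growth_pos hR hρ
  set V := 2 * ((2 * gradBound R ρ) ^ 2 + max c 0) + max c 0 with hV
  have hV0 : 0 ≤ V := by positivity
  set a := min 1 ε₀
  have ha : 0 < a := lt_min one_pos hε₀
  -- The first bound makes the total variance term at most κ/2 times the squared error; the second
  -- is Bernstein's condition for functions bounded by 2R.
  set l := min (κ / (4 * (V + 1))) (1 / (4 * R + 1))
  have hl : 0 < l := lt_min (by positivity) (by positivity)
  have hlB : l * (2 * (2 * R)) ≤ 1 := by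
    have h1 : l * (2 * (2 * R)) ≤ 1 / (4 * R + 1) * (2 * (2 * R)) := by
      gcongr
      exact min_le_right _ _
    refine h1.trans ?_
    rw [div_mul_eq_mul_div, div_le_one (by positivity)]
    linarith
  have hlV : 2 * l * V ≤ κ / 2 := by
    have h1 : 2 * l * V ≤ 2 * (κ / (4 * (V + 1))) * V := by
      gcongr
      exact min_le_left _ _
    refine h1.trans ?_
    rw [mul_div_assoc', div_mul_eq_mul_div, div_le_div_iff₀ (by positivity) two_pos]
    nlinarith
  set M := deviationConst l (entropyConst K a) with hM
  have hM0 : 0 < M := by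
    rw [hM, deviationConst]
    positivity
  -- Two deviations contribute 2M, replacing t + 2 by 2 (t + 1) doubles it, and absorbing κ/2
  -- doubles it again.
  refine ⟨8 * M / κ, by positivity, ?_⟩
  intro d μ Φ φ₀ hμP hμ hΦ hφ₀ hE hP W _ Pr n X Y φhat hPr hn hX hY hest t ht
  have hνP : IsProbabilityMeasure (μ.map (grad φ₀)) :=
    Measure.isProbabilityMeasure_map (measurable_grad φ₀).aemeasurable
  have hn' : (0 : ℝ) < n := by positivity
  have h₀ := hΦ φ₀ hφ₀
  have hne : Φ.Nonempty := ⟨φ₀, hφ₀⟩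
  obtain ⟨D₁, hD₁, hD₁'⟩ := exists_event_forall_class_deviation_le hE hne hγ hγ₁ ha
    (min_le_left _ _) (min_le_right _ _) hn hX (fun s : Φ => primalDiff ρ φ₀ s.1)
    (fun s => measurable_primalDiff (hΦ _ s.2) h₀ hρ)
    (fun s => abs_primalDiff_le (hΦ _ s.2) h₀ hρ)
    (fun s u e he z => by
      by_cases hz : z ∈ Metric.closedBall (0 : Space d) ρ
      · rw [primalDiff_of_mem hz, primalDiff_of_mem hz, abs_sub_comm]
        simpa using he z (closedBall_subset_domain hρ hz)
      · simpa [primalDiff, Set.indicator_of_notMem hz] using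
          (abs_nonneg _).trans (he 0 (zero_mem_domain d)))
    hl hlB (t := t + 1) (by linarith)
  obtain ⟨D₂, hD₂, hD₂'⟩ := exists_event_forall_class_deviation_le hE hne hγ hγ₁ ha
    (min_le_left _ _) (min_le_right _ _) hn hY (fun s : Φ => dualDiff φ₀ s.1)
    (fun s => measurable_dualDiff (hΦ _ s.2) h₀)
    (fun s => abs_dualDiff_le (hΦ _ s.2) h₀)
    (fun s u e he z => by
      have h1 := (hΦ _ s.2).abs_conj_sub_le (hΦ _ u.2) he z
      rw [dualDiff, dualDiff, abs_sub_comm]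
      simpa using h1)
    hl hlB (t := t + 1) (by linarith)
  have hXmem : ∀ᵐ ω ∂Pr, ∀ i, X i ω ∈ Metric.closedBall (0 : Space d) ρ := by
    rw [ae_all_iff]
    intro i
    have h1 := ae_mem_closedBall hμ
    rw [← hX.2.1 i] at h1
    exact ae_of_ae_map (hX.1 i).aemeasurable h1
  have hgood : ∀ᵐ ω ∂Pr, ω ∈ {ω | ENNReal.ofReal (8 * M / κ * (rate γ n ^ 2 + (t + 1) / n)) <
      mapError μ (φhat ω) φ₀} → ω ∈ D₁ ∪ D₂ := by
    filter_upwards [hest, hXmem] with ω hω hxω hlt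
    by_contra hD
    rw [Set.mem_union, not_or] at hD
    refine absurd hlt (not_lt.2 ?_)
    have hφ := hΦ _ hω.1
    rw [mapError_eq hφ h₀ hρ hμ]
    refine ENNReal.ofReal_le_ofReal ?_
    have h1 := growth_mul_gradDistSq_le_deviation hΦ hφ₀ hρ hμ hxω hω
    have h2 := hD₁' ω hD.1 ⟨φhat ω, hω.1⟩
    have h3 := hD₂' ω hD.2 ⟨φhat ω, hω.1⟩
    have h4 := mul_le_mul_of_nonneg_left (variance_primalDiff_le hφ h₀ hρ hμ hP)
      (by positivity : 0 ≤ 2 * l)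
    have h5 := mul_le_mul_of_nonneg_left (variance_dualDiff_le hφ h₀ hρ hμ hP)
      (by positivity : 0 ≤ 2 * l)
    have h6 := mul_le_mul_of_nonneg_right hlV (gradDistSq_nonneg (μ := μ) (φ := φhat ω) (φ₀ := φ₀))
    have h7 : (t + 1 + 1) / (n : ℝ) ≤ 2 * ((t + 1) / n) := by
      rw [← mul_div_assoc]
      gcongr
      linarith
    have h8 : M * (rate γ n ^ 2 + (t + 1 + 1) / n) ≤ M * (2 * (rate γ n ^ 2 + (t + 1) / n)) := by
      gcongr
      nlinarith [sq_nonneg (rate γ n)]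
    rw [div_mul_eq_mul_div, le_div_iff₀ hκ]
    have h9 : 2 * l * V * gradDistSq μ (φhat ω) φ₀ = 2 * l * (max c 0 * gradDistSq μ (φhat ω) φ₀) +
        2 * l * (2 * ((2 * gradBound R ρ) ^ 2 + max c 0) * gradDistSq μ (φhat ω) φ₀) := by
      rw [hV]
      ring
    simp only at h2 h3
    linarith
  refine (measure_mono_ae hgood).trans ((measure_union_le _ _).trans ((add_le_add hD₁ hD₂).trans ?_))
  rw [← ENNReal.ofReal_add (Real.exp_pos _).le (Real.exp_pos _).le]
  refine ENNReal.ofReal_le_ofReal ?_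
  -- Each event was taken at level t + 1, and 2 ≤ e pays for the union.
  have h1 : Real.exp (-t) = Real.exp 1 * Real.exp (-(t + 1)) := by
    rw [← Real.exp_add]
    congr 1
    ring
  rw [h1]
  nlinarith [Real.add_one_le_exp (1 : ℝ), Real.exp_pos (-(t + 1))]

end Assembly

end SemidualMap

end

/-! ### The main theorem -/

theorem mainTheorem9 (γ R K ε₀ c ρ : ℝ) (hγ₀ : 0 ≤ γ) (hγ₁ : γ < 1) (hε₀ : 0 < ε₀)
    (hρ : ρ < 1) :
    ∃ C : ℝ, 0 < C ∧
      ∀ (d : ℕ) (μ ν : Measure (SemidualMap.Space d)) (Φ : Set (SemidualMap.Space d → EReal))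
        (φ₀ : SemidualMap.Space d → EReal),
        IsProbabilityMeasure μ →
        μ.support ⊆ Metric.closedBall 0 ρ →
        ν.support ⊆ SemidualMap.domain d →
        (∀ φ ∈ Φ, SemidualMap.IsPotential R φ) →
        φ₀ ∈ Φ →
        ν = μ.map (SemidualMap.grad φ₀) →
        SemidualMap.IsConvexClass Φ →
        SemidualMap.EntropyBound γ K ε₀ Φ →
        SemidualMap.Poincare c μ →
        ∀ (W : Type u) [MeasurableSpace W] (Pr : Measure W) (n : ℕ)
          (X Y : Fin n → W → SemidualMap.Space d) (φhat : W → SemidualMap.Space d → EReal),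
          IsProbabilityMeasure Pr →
          1 ≤ n →
          SemidualMap.IsIIDSample Pr X μ →
          SemidualMap.IsIIDSample Pr Y ν →
          (∀ᵐ ω ∂Pr, SemidualMap.IsSemidualEstimator Φ (fun i => X i ω) (fun i => Y i ω)
            (φhat ω)) →
          (∀ t : ℝ, 0 ≤ t →
            Pr {ω | ENNReal.ofReal
                (C * ((Real.log n / n) ^ (2 / (2 + γ)) + (t + 1) / n)) <
              SemidualMap.mapError μ (φhat ω) φ₀} ≤ ENNReal.ofReal (Real.exp (-t))) ∧
          (2 ≤ n →
            ∫⁻ ω, SemidualMap.mapError μ (φhat ω) φ₀ ∂Pr ≤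
              ENNReal.ofReal (C * (Real.log n / n) ^ (2 / (2 + γ)))) := by
  rcases lt_or_ge R 0 with hR | hR
  -- No potential exists when R < 0.
  · refine ⟨1, one_pos, ?_⟩
    intro d μ ν Φ φ₀ hμP hμ hν hΦ hφ₀
    exact absurd (hΦ φ₀ hφ₀).nonneg (not_le.2 hR)
  obtain ⟨C, hC, hmain⟩ := SemidualMap.exists_const_measure_mapError_gt_le.{u} (K := K) (c := c)
    hγ₀ hγ₁ hε₀ hρ hR
  have hle : C ≤ 7 * C + (2 * SemidualMap.gradBound R ρ) ^ 2 := by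
    nlinarith [sq_nonneg (2 * SemidualMap.gradBound R ρ)]
  refine ⟨7 * C + (2 * SemidualMap.gradBound R ρ) ^ 2, by positivity, ?_⟩
  intro d μ ν Φ φ₀ hμP hμ _ hΦ hφ₀ hν _ hE hP W _ Pr n X Y φhat hPr hn hX hY hest
  subst hν
  have hn' : (0 : ℝ) < n := by exact_mod_cast hn
  refine ⟨fun t ht => ?_, fun hn2 => ?_⟩
  -- For n = 1 the rate vanishes but (t + 1)/n ≥ 1, so the uniform bound on the error, included in
  -- the constant, suffices.
  · rcases hn.eq_or_lt with rfl | hn2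
    · refine (le_of_eq ?_).trans zero_le
      rw [← nonpos_iff_eq_zero]
      refine (measure_mono_ae (t := ∅) ?_).trans measure_empty.le
      filter_upwards [hest] with ω hω hlt
      refine absurd hlt (not_lt.2 ?_)
      rw [SemidualMap.mapError_eq (hΦ _ hω.1) (hΦ _ hφ₀) hρ hμ]
      refine ENNReal.ofReal_le_ofReal ?_
      refine (SemidualMap.gradDistSq_le (hΦ _ hω.1) (hΦ _ hφ₀) hρ hμ).trans ?_
      have h1 : 0 ≤ (Real.log ((1 : ℕ) : ℝ) / ((1 : ℕ) : ℝ)) ^ (2 / (2 + γ)) :=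
        Real.rpow_nonneg (by simp) _
      have h2 : 1 ≤ (Real.log ((1 : ℕ) : ℝ) / ((1 : ℕ) : ℝ)) ^ (2 / (2 + γ)) +
          (t + 1) / ((1 : ℕ) : ℝ) := by
        rw [Nat.cast_one, div_one (t + 1)] at *
        linarith
      have h3 : 0 ≤ 7 * C + (2 * SemidualMap.gradBound R ρ) ^ 2 := by positivity
      nlinarith [mul_le_mul_of_nonneg_left h2 h3]
    · refine (measure_mono fun ω hω => ?_).trans
        (hmain d μ Φ φ₀ hμP hμ hΦ hφ₀ hE hP W Pr n X Y φhat hPr hn2 hX hY hest t ht)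
      refine (ENNReal.ofReal_le_ofReal ?_).trans_lt hω
      rw [SemidualMap.rate_sq hn2]
      have := SemidualMap.log_div_pos hn2
      gcongr
  · have h0 := sq_nonneg (SemidualMap.rate γ n)
    have hinv := SemidualMap.inv_le_two_mul_rate_sq hγ₀ hn2
    have key := SemidualMap.lintegral_le_of_exp_tail (Pr := Pr)
      (F := fun ω => SemidualMap.mapError μ (φhat ω) φ₀)
      (a := ENNReal.ofReal (C * (SemidualMap.rate γ n ^ 2 + (n : ℝ)⁻¹)))
      (b := ENNReal.ofReal (C * (n : ℝ)⁻¹)) (ENNReal.ofReal_pos.2 (by positivity)).ne'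
      (fun j => by
        refine le_trans (le_of_eq ?_) (hmain d μ Φ φ₀ hμP hμ hΦ hφ₀ hE hP W Pr n X Y φhat hPr hn2
          hX hY hest j j.cast_nonneg)
        congr 1
        ext ω
        rw [Set.mem_ofPred_eq, Set.mem_ofPred_eq, ← ENNReal.ofReal_natCast j,
          ← ENNReal.ofReal_mul (by positivity), ← ENNReal.ofReal_add (by positivity)
          (by positivity)]
        have : C * (SemidualMap.rate γ n ^ 2 + (n : ℝ)⁻¹) + C * (n : ℝ)⁻¹ * j =
            C * (SemidualMap.rate γ n ^ 2 + (j + 1) / n) := by ring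
        rw [this])
    refine key.trans ?_
    rw [← ENNReal.ofReal_ofNat 2, ← ENNReal.ofReal_mul (by positivity),
      ← ENNReal.ofReal_add (by positivity) (by positivity), ← SemidualMap.rate_sq hn2]
    refine ENNReal.ofReal_le_ofReal ?_
    -- The integrated tail is C (r² + 3/n), and 1/n ≤ 2 r² gives the factor 7.
    nlinarith [mul_le_mul_of_nonneg_left hinv hC.le,
      mul_nonneg (sq_nonneg (2 * SemidualMap.gradBound R ρ)) h0]
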